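/- Let $\mathcal K$ be a tensor triangulated category (a triangulated category with a symmetric monoidal structure that is exact in each variable, with suspension isomorphisms $\Sigma a\otimes b\simeq\Sigma(a\otimes b)\simeq a\otimes\Sigma b$ compatible with the symmetry, unitors and associator, such that the two composites $\Sigma a\otimes\Sigma b\simeq\Sigma^2(a\otimes b)$ differ by $-1$). An endomorphism $f:X\to X$ is $\otimes$-balanced if $f\otimes X=X\otimes f$; let $E_X$ be the ring of $\otimes$-balanced endomorphisms of $X$. For a non-empty collection $\Phi$ of objects closed under $\otimes$, let $R_{\mathcal K,\Phi}$ be the set of pairs $(X,f)$ with $X\in\Phi$, $f\in E_X$, modulo the smallest equivalence relation with $(X,f)\sim(a\otimes X,a\otimes f)$ and $(X,f)\sim(X\otimes a,f\otimes a)$ for all $a\in\Phi$; it is a commutative ring with $[f_X]+[g_Y]=[f\otimes Y+X\otimes g]$ and $[f_X][g_Y]=[f\otimes g]$. Let $\mathrm{Spc}(\mathcal K)$ be the set of prime thick $\otimes$-ideals with the topology having the sets $\mathrm{supp}(a)=\{\mathcal P\mid a\notin\mathcal P\}$ as a basis of closed sets, let $\mathcal Z_{\mathcal K,\Phi}=\bigcap_{X\in\Phi}\mathrm{supp}(X)$,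 and let $$\rho_{\mathcal K,\Phi}:\mathcal Z_{\mathcal K,\Phi}\to\mathrm{Spec}(R_{\mathcal K,\Phi}),\qquad \mathcal P\mapsto\{[f]\mid\mathrm{cone}(f)\notin\mathcal P\}.$$ For an object $X$, write $R_{\mathcal K,X}$ and $\rho_{\mathcal K,X}:\mathrm{supp}(X)\to\mathrm{Spec}(R_{\mathcal K,X})$ for the case $\Phi=\{X^{\otimes n}\mid n\ge1\}$; for a closed set $\mathcal Z\subset\mathrm{Spc}(\mathcal K)$, write $R_{\mathcal K,\mathcal Z}$ and $\rho_{\mathcal K,\mathcal Z}:\mathcal Z\to\mathrm{Spec}(R_{\mathcal K,\mathcal Z})$ for the case $\Phi=\{a\mid\mathrm{supp}(a)\supset\mathcal Z\}$. Collections of objects such as $\{X^{\otimes n}\}$ and $i(\Phi)$ below are taken up to isomorphism. Let $i:\mathcal K\to\mathcal K^\natural$ be an idempotent completion of $\mathcal K$: $\mathcal K^\natural$ is an idempotent-complete tensor triangulated category and $i$ is a fully faithful morphism of tensor triangulated categories (an exact strong symmetric monoidal functor compatible with the suspension isomorphisms) such that every object of $\mathcal K^\natural$ is a direct summand of some $i(a)$,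 $a\in\mathcal K$. Then $i^*:\mathrm{Spc}(\mathcal K^\natural)\to\mathrm{Spc}(\mathcal K)$, $\mathcal Q\mapsto i^{-1}(\mathcal Q)$, is a homeomorphism, and the following hold. 1. For every non-empty $\otimes$-multiplicative $\Phi\subset\mathcal K$, the map $[f]\mapsto[i(f)]$ is a ring isomorphism $R_{\mathcal K,\Phi}\simeq R_{\mathcal K^\natural,i(\Phi)}$, and $(i^*)^{-1}(\mathcal Z_{\mathcal K,\Phi})=\mathcal Z_{\mathcal K^\natural,i(\Phi)}$. Under these identifications $\rho_{\mathcal K,\Phi}=\rho_{\mathcal K^\natural,i(\Phi)}$. 2. For every object $X$ of $\mathcal K^\natural$ there is $Y\in\mathcal K$ with $i(Y)\simeq X\oplus\Sigma X$. For every such $Y$ (and every such isomorphism) one has $(i^*)^{-1}(\mathrm{supp}(Y))=\mathrm{supp}(X)$, and there is a ring isomorphism $R_{\mathcal K^\natural,X}\simeq R_{\mathcal K,Y}$ under which $\rho_{\mathcal K^\natural,X}=\rho_{\mathcal K,Y}$. It is canonical: it sends $[f]$, for $f\in E_X$, to the class of the endomorphism of $Y$ corresponding to $f\oplus\Sigma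 f$, and it is compatible with the natural maps $R_{\mathcal K^\natural,X}\to R_{\mathcal K^\natural,\Psi}\leftarrow R_{\mathcal K,Y}$ for every $\otimes$-multiplicative $\Psi\subset\mathcal K^\natural$ that contains the objects isomorphic to some $X^{\otimes n}$ and the images under $i$ of the objects isomorphic to some $Y^{\otimes n}$, $n\ge1$. 3. For every closed $\mathcal Z\subset\mathrm{Spc}(\mathcal K)$, with $\mathcal Z'=(i^*)^{-1}(\mathcal Z)$, the map $[f]\mapsto[i(f)]$ is a ring isomorphism $R_{\mathcal K,\mathcal Z}\simeq R_{\mathcal K^\natural,\mathcal Z'}$, and under this isomorphism and $\mathcal Z\simeq\mathcal Z'$ the comparison map $\rho_{\mathcal K,\mathcal Z}$ coincides with $\rho_{\mathcal K^\natural,\mathcal Z'}$. -/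

import Mathlib

open CategoryTheory MonoidalCategory Limits Pretriangulated ZeroObject

universe v u v' u'

/-! ### Tensor triangulated categories -/

namespace TTGeom

/-- A tensor triangulated category: a triangulated category `K` with a symmetric monoidal structure
such that `X ⊗ -` and `- ⊗ X` are exact, for isomorphisms `Σa ⊗ b ≅ Σ(a ⊗ b)` and
`a ⊗ Σb ≅ Σ(a ⊗ b)` natural in both variables. The field `commShift₂` contains these isomorphisms
(for all `Σⁿ`), their naturality and the anti-commutation of the two ways from `Σa ⊗ Σb` to
`Σ²(a ⊗ b)`; the other fields are exactness and the compatibility with the symmetry, the unitors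
and the associator. -/
class TensorTriangulated (K : Type u) [Category.{v} K] [Preadditive K] [HasZeroObject K]
    [HasShift K ℤ] [∀ n : ℤ, (shiftFunctor K n).Additive] [Pretriangulated K] [IsTriangulated K]
    [MonoidalCategory K] [MonoidalPreadditive K] [SymmetricCategory K] where
  commShift₂ : (curriedTensor K).CommShift₂Int
  tensorLeft_isTriangulated (X : K) : (tensorLeft X).IsTriangulated
  tensorRight_isTriangulated (X : K) : (tensorRight X).IsTriangulated
  braiding_shift (X Y : K) (n : ℤ) :
    (β_ (X⟦n⟧) Y).hom ≫ ((tensorLeft Y).commShiftIso n).hom.app X =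
      ((tensorRight Y).commShiftIso n).hom.app X ≫ (β_ X Y).hom⟦n⟧'
  rightUnitor_shift (X : K) (n : ℤ) :
    ((tensorRight (𝟙_ K)).commShiftIso n).hom.app X ≫ (ρ_ X).hom⟦n⟧' = (ρ_ (X⟦n⟧)).hom
  leftUnitor_shift (X : K) (n : ℤ) :
    ((tensorLeft (𝟙_ K)).commShiftIso n).hom.app X ≫ (λ_ X).hom⟦n⟧' = (λ_ (X⟦n⟧)).hom
  associator_shift₁ (X Y Z : K) (n : ℤ) :
    (α_ (X⟦n⟧) Y Z).hom ≫ ((tensorRight (Y ⊗ Z)).commShiftIso n).hom.app X =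
      ((tensorRight Y).commShiftIso n).hom.app X ▷ Z ≫
        ((tensorRight Z).commShiftIso n).hom.app (X ⊗ Y) ≫ (α_ X Y Z).hom⟦n⟧'
  associator_shift₂ (X Y Z : K) (n : ℤ) :
    (α_ X (Y⟦n⟧) Z).hom ≫ X ◁ ((tensorRight Z).commShiftIso n).hom.app Y ≫
        ((tensorLeft X).commShiftIso n).hom.app (Y ⊗ Z) =
      ((tensorLeft X).commShiftIso n).hom.app Y ▷ Z ≫
        ((tensorRight Z).commShiftIso n).hom.app (X ⊗ Y) ≫ (α_ X Y Z).hom⟦n⟧'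
  associator_shift₃ (X Y Z : K) (n : ℤ) :
    (α_ X Y (Z⟦n⟧)).hom ≫ X ◁ ((tensorLeft Y).commShiftIso n).hom.app Z ≫
        ((tensorLeft X).commShiftIso n).hom.app (Y ⊗ Z) =
      ((tensorLeft (X ⊗ Y)).commShiftIso n).hom.app Z ≫ (α_ X Y Z).hom⟦n⟧'

attribute [reducible] TensorTriangulated.commShift₂
attribute [instance] TensorTriangulated.commShift₂ TensorTriangulated.tensorLeft_isTriangulated
  TensorTriangulated.tensorRight_isTriangulated
set_option linter.unusedSimpArgs false
set_option linter.unusedSectionVars false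

/-! ### Balanced endomorphisms -/

section Balanced

variable {K : Type u} [Category.{v} K] [MonoidalCategory K]

/-- An endomorphism `f : X ⟶ X` is `⊗`-balanced if `f ⊗ X = X ⊗ f` on `X ⊗ X`. -/
def IsBalanced {X : K} (f : X ⟶ X) : Prop := f ▷ X = X ◁ f

lemma IsBalanced.id (X : K) : IsBalanced (𝟙 X) := by simp [IsBalanced]

lemma IsBalanced.comp {X : K} {f g : X ⟶ X} (hf : IsBalanced f) (hg : IsBalanced g) :
    IsBalanced (f ≫ g) := by
  unfold IsBalanced at *
  rw [comp_whiskerRight, whiskerLeft_comp, hf, hg]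

lemma IsBalanced.tensorHom [SymmetricCategory K] {X Y : K} {f : X ⟶ X} {g : Y ⟶ Y}
    (hf : IsBalanced f) (hg : IsBalanced g) : IsBalanced (f ⊗ₘ g) := by
  unfold IsBalanced at *
  have h : Mono (tensorμ X Y X Y) := ⟨fun a b hab => by
    simpa using congrArg (fun t => t ≫ tensorδ X Y X Y) hab⟩
  rw [← cancel_mono (tensorμ X Y X Y), tensorμ_natural_left, tensorμ_natural_right, hf, hg]

lemma IsBalanced.whiskerLeft [SymmetricCategory K] {X : K} {f : X ⟶ X} (hf : IsBalanced f)
    (a : K) : IsBalanced (a ◁ f) := by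
  simpa using (IsBalanced.id a).tensorHom hf

lemma IsBalanced.whiskerRight [SymmetricCategory K] {X : K} {f : X ⟶ X} (hf : IsBalanced f)
    (a : K) : IsBalanced (f ▷ a) := by
  simpa using hf.tensorHom (IsBalanced.id a)

lemma IsBalanced.whiskerRight_eq {X Y : K} {f : X ⟶ X} {g : Y ⟶ Y} (hf : IsBalanced f)
    (e : X ≅ Y) (h : f ≫ e.hom = e.hom ≫ g) : f ▷ Y = X ◁ g := by
  have hg : g = e.inv ≫ f ≫ e.hom := by rw [h, Iso.inv_hom_id_assoc]
  rw [hg, whiskerLeft_comp, whiskerLeft_comp, ← show f ▷ X = X ◁ f from hf, ← whisker_exchange,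
    ← whiskerLeft_comp_assoc, Iso.inv_hom_id, whiskerLeft_id, Category.id_comp]

variable [Preadditive K] [MonoidalPreadditive K]

lemma IsBalanced.zero (X : K) : IsBalanced (0 : X ⟶ X) := by simp [IsBalanced]

lemma IsBalanced.add {X : K} {f g : X ⟶ X} (hf : IsBalanced f) (hg : IsBalanced g) :
    IsBalanced (f + g) := by
  unfold IsBalanced at *
  rw [MonoidalPreadditive.add_whiskerRight, MonoidalPreadditive.whiskerLeft_add, hf, hg]

lemma IsBalanced.neg {X : K} {f : X ⟶ X} (hf : IsBalanced f) : IsBalanced (-f) := by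
  unfold IsBalanced at *
  have h1 : (-f) ▷ X = -(f ▷ X) := (tensorRight X).map_neg
  have h2 : X ◁ (-f) = -(X ◁ f) := (tensorLeft X).map_neg
  rw [h1, h2, hf]

end Balanced

/-! ### Multiplicative sets of objects and the ring `R_Φ` -/

/-- A non-empty collection of objects closed under `⊗`. -/
structure MulSet (K : Type u) [Category.{v} K] [MonoidalCategory K] where
  mem : ObjectProperty K
  nonempty : ∃ X, mem X
  tensor_mem : ∀ {X Y : K}, mem X → mem Y → mem (X ⊗ Y)

section Ring

variable {K : Type u} [Category.{v} K] [MonoidalCategory K] [SymmetricCategory K]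

/-- The pairs `(X, f)` with `X ∈ Φ` and `f ∈ E_X`. -/
structure Rep (Φ : MulSet K) where
  X : K
  mem : Φ.mem X
  f : X ⟶ X
  bal : IsBalanced f

/-- The pairs of representatives `(X, f) ∼ (a ⊗ X, a ⊗ f)` and `(X, f) ∼ (X ⊗ a, f ⊗ a)`,
for `a ∈ Φ`. -/
inductive Rep.Step (Φ : MulSet K) : Rep Φ → Rep Φ → Prop
  | left (a : K) (ha : Φ.mem a) (r : Rep Φ) :
      Rep.Step Φ r ⟨a ⊗ r.X, Φ.tensor_mem ha r.mem, a ◁ r.f, r.bal.whiskerLeft a⟩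
  | right (a : K) (ha : Φ.mem a) (r : Rep Φ) :
      Rep.Step Φ r ⟨r.X ⊗ a, Φ.tensor_mem r.mem ha, r.f ▷ a, r.bal.whiskerRight a⟩

/-- The set `R_Φ`: the quotient of the set of pairs `(X, f)`, `X ∈ Φ`, `f ∈ E_X`, by the smallest
equivalence relation containing `Rep.Step` (`Quot` is the quotient by the equivalence relation
that a relation generates). -/
def R (Φ : MulSet K) : Type (max u v) := Quot (Rep.Step Φ)

namespace R

variable {Φ : MulSet K}

/-- The class `[f_X]` in `R_Φ` of `f ∈ E_X`, `X ∈ Φ`. -/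
def mk (X : K) (hX : Φ.mem X) (f : X ⟶ X) (hf : IsBalanced f) : R Φ := Quot.mk _ ⟨X, hX, f, hf⟩

lemma ind {p : R Φ → Prop} (h : ∀ X hX f hf, p (mk X hX f hf)) (r : R Φ) : p r :=
  Quot.ind (fun a => h a.X a.mem a.f a.bal) r

lemma mk_left {X : K} (hX : Φ.mem X) {f : X ⟶ X} (hf : IsBalanced f) {a : K} (ha : Φ.mem a) :
    mk (a ⊗ X) (Φ.tensor_mem ha hX) (a ◁ f) (hf.whiskerLeft a) = mk X hX f hf :=
  (Quot.sound (Rep.Step.left a ha ⟨X, hX, f, hf⟩)).symm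

lemma mk_right {X : K} (hX : Φ.mem X) {f : X ⟶ X} (hf : IsBalanced f) {a : K} (ha : Φ.mem a) :
    mk (X ⊗ a) (Φ.tensor_mem hX ha) (f ▷ a) (hf.whiskerRight a) = mk X hX f hf :=
  (Quot.sound (Rep.Step.right a ha ⟨X, hX, f, hf⟩)).symm

lemma mk_congr {X : K} {hX : Φ.mem X} {f g : X ⟶ X} {hf : IsBalanced f} {hg : IsBalanced g}
    (h : f = g) : mk X hX f hf = mk X hX g hg := by subst h; rfl

/-- Endomorphisms that correspond under an isomorphism have the same class. -/
lemma mk_iso {X Y : K} {hX : Φ.mem X} {hY : Φ.mem Y} {f : X ⟶ X} {g : Y ⟶ Y}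
    {hf : IsBalanced f} {hg : IsBalanced g} (e : X ≅ Y) (h : f ≫ e.hom = e.hom ≫ g) :
    mk X hX f hf = mk Y hY g hg := by
  rw [← mk_right hX hf hY, ← mk_left hY hg hX]
  exact mk_congr (hf.whiskerRight_eq e h)

/-- The multiplication `[f_X] · [g_Y] = [f ⊗ g] = [(f ⊗ Y) ∘ (X ⊗ g)]`. -/
instance : Mul (R Φ) where
  mul := Quot.lift₂
    (fun r s => mk (r.X ⊗ s.X) (Φ.tensor_mem r.mem s.mem) (r.f ⊗ₘ s.f) (r.bal.tensorHom s.bal))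
    (by
      rintro ⟨X, hX, f, hf⟩ _ _ (⟨a, ha, ⟨Y, hY, g, hg⟩⟩ | ⟨a, ha, ⟨Y, hY, g, hg⟩⟩)
      · rw [← mk_right _ _ ha]
        refine mk_iso (α_ X Y a ≪≫ whiskerLeftIso X (β_ Y a)) ?_
        simp only [Iso.trans_hom, Iso.symm_hom, whiskerLeftIso_hom, whiskerRightIso_hom, ← id_tensorHom, ← tensorHom_id, Category.assoc, associator_naturality, associator_naturality_assoc, associator_inv_naturality_assoc, associator_inv_naturality, tensorHom_comp_tensorHom, tensorHom_comp_tensorHom_assoc, BraidedCategory.braiding_naturality, Category.id_comp, Category.comp_id]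
      · rw [← mk_right _ _ ha]
        refine mk_iso (α_ X Y a) ?_
        simp only [Iso.trans_hom, Iso.symm_hom, whiskerLeftIso_hom, whiskerRightIso_hom, ← id_tensorHom, ← tensorHom_id, Category.assoc, associator_naturality, associator_naturality_assoc, associator_inv_naturality_assoc, associator_inv_naturality, tensorHom_comp_tensorHom, tensorHom_comp_tensorHom_assoc, BraidedCategory.braiding_naturality, Category.id_comp, Category.comp_id])
    (by
      rintro _ _ ⟨X, hX, f, hf⟩ (⟨a, ha, ⟨Y, hY, g, hg⟩⟩ | ⟨a, ha, ⟨Y, hY, g, hg⟩⟩)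
      · rw [← mk_left _ _ ha]
        refine mk_iso (α_ a Y X).symm ?_
        simp only [Iso.trans_hom, Iso.symm_hom, whiskerLeftIso_hom, whiskerRightIso_hom, ← id_tensorHom, ← tensorHom_id, Category.assoc, associator_naturality, associator_naturality_assoc, associator_inv_naturality_assoc, associator_inv_naturality, tensorHom_comp_tensorHom, tensorHom_comp_tensorHom_assoc, BraidedCategory.braiding_naturality, Category.id_comp, Category.comp_id]
      · rw [← mk_left _ _ ha]
        refine mk_iso ((α_ a Y X).symm ≪≫ whiskerRightIso (β_ a Y) X) ?_
        simp only [Iso.trans_hom, Iso.symm_hom, whiskerLeftIso_hom, whiskerRightIso_hom, ← id_tensorHom, ← tensorHom_id, Category.assoc, associator_naturality, associator_naturality_assoc, associator_inv_naturality_assoc, associator_inv_naturality, tensorHom_comp_tensorHom, tensorHom_comp_tensorHom_assoc, BraidedCategory.braiding_naturality, Category.id_comp, Category.comp_id])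

lemma mk_mul_mk {X Y : K} (hX : Φ.mem X) (hY : Φ.mem Y) {f : X ⟶ X} {g : Y ⟶ Y}
    (hf : IsBalanced f) (hg : IsBalanced g) :
    mk X hX f hf * mk Y hY g hg =
      mk (X ⊗ Y) (Φ.tensor_mem hX hY) (f ⊗ₘ g) (hf.tensorHom hg) := rfl

/-- The unit `1 = [id_X]`, which does not depend on `X ∈ Φ`. -/
noncomputable instance : One (R Φ) where
  one := mk Φ.nonempty.choose Φ.nonempty.choose_spec (𝟙 _) (IsBalanced.id _)

lemma one_eq {X : K} (hX : Φ.mem X) : (1 : R Φ) = mk X hX (𝟙 X) (IsBalanced.id X) := by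
  change mk _ Φ.nonempty.choose_spec (𝟙 _) (IsBalanced.id _) = _
  rw [← mk_right _ _ hX, ← mk_left hX _ Φ.nonempty.choose_spec]
  exact mk_congr (by simp)

lemma mk_mul_mk' {X : K} (hX : Φ.mem X) {f g : X ⟶ X} (hf : IsBalanced f) (hg : IsBalanced g) :
    mk X hX f hf * mk X hX g hg = mk X hX (f ≫ g) (hf.comp hg) := by
  rw [mk_mul_mk, ← mk_right hX (hf.comp hg) hX]
  refine mk_congr ?_
  rw [comp_whiskerRight, show g ▷ X = X ◁ g from hg, MonoidalCategory.tensorHom_def]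

lemma exists_rep₂ (r s : R Φ) : ∃ (X : K) (hX : Φ.mem X) (f g : X ⟶ X) (hf : IsBalanced f)
    (hg : IsBalanced g), r = mk X hX f hf ∧ s = mk X hX g hg := by
  induction r using ind with | _ X hX f hf
  induction s using ind with | _ Y hY g hg
  exact ⟨X ⊗ Y, Φ.tensor_mem hX hY, _, _, hf.whiskerRight Y, hg.whiskerLeft X,
    (mk_right _ _ hY).symm, (mk_left _ _ hX).symm⟩

lemma exists_rep₃ (r s t : R Φ) : ∃ (X : K) (hX : Φ.mem X) (f g h : X ⟶ X) (hf : IsBalanced f)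
    (hg : IsBalanced g) (hh : IsBalanced h),
    r = mk X hX f hf ∧ s = mk X hX g hg ∧ t = mk X hX h hh := by
  obtain ⟨X, hX, f, g, hf, hg, rfl, rfl⟩ := exists_rep₂ r s
  induction t using ind with | _ Y hY h hh
  exact ⟨X ⊗ Y, Φ.tensor_mem hX hY, _, _, _, hf.whiskerRight Y, hg.whiskerRight Y,
    hh.whiskerLeft X, (mk_right _ _ hY).symm, (mk_right _ _ hY).symm, (mk_left _ _ hX).symm⟩

variable [Preadditive K] [MonoidalPreadditive K]

/-- The addition `[f_X] + [g_Y] = [f ⊗ Y + X ⊗ g]`. -/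
instance : Add (R Φ) where
  add := Quot.lift₂
    (fun r s => mk (r.X ⊗ s.X) (Φ.tensor_mem r.mem s.mem) (r.f ▷ s.X + r.X ◁ s.f)
      ((r.bal.whiskerRight _).add (s.bal.whiskerLeft _)))
    (by
      rintro ⟨X, hX, f, hf⟩ _ _ (⟨a, ha, ⟨Y, hY, g, hg⟩⟩ | ⟨a, ha, ⟨Y, hY, g, hg⟩⟩)
      · rw [← mk_right _ _ ha]
        refine mk_iso (α_ X Y a ≪≫ whiskerLeftIso X (β_ Y a)) ?_
        simp only [MonoidalPreadditive.whiskerLeft_add, MonoidalPreadditive.add_whiskerRight,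
          Preadditive.add_comp, Preadditive.comp_add]
        simp only [Iso.trans_hom, Iso.symm_hom, whiskerLeftIso_hom, whiskerRightIso_hom, ← id_tensorHom, ← tensorHom_id, Category.assoc, associator_naturality, associator_naturality_assoc, associator_inv_naturality_assoc, associator_inv_naturality, tensorHom_comp_tensorHom, tensorHom_comp_tensorHom_assoc, BraidedCategory.braiding_naturality, Category.id_comp, Category.comp_id, id_tensorHom_id]
      · rw [← mk_right _ _ ha]
        refine mk_iso (α_ X Y a) ?_
        simp only [MonoidalPreadditive.whiskerLeft_add, MonoidalPreadditive.add_whiskerRight,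
          Preadditive.add_comp, Preadditive.comp_add]
        simp only [Iso.trans_hom, Iso.symm_hom, whiskerLeftIso_hom, whiskerRightIso_hom, ← id_tensorHom, ← tensorHom_id, Category.assoc, associator_naturality, associator_naturality_assoc, associator_inv_naturality_assoc, associator_inv_naturality, tensorHom_comp_tensorHom, tensorHom_comp_tensorHom_assoc, BraidedCategory.braiding_naturality, Category.id_comp, Category.comp_id, id_tensorHom_id])
    (by
      rintro _ _ ⟨X, hX, f, hf⟩ (⟨a, ha, ⟨Y, hY, g, hg⟩⟩ | ⟨a, ha, ⟨Y, hY, g, hg⟩⟩)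
      · rw [← mk_left _ _ ha]
        refine mk_iso (α_ a Y X).symm ?_
        simp only [MonoidalPreadditive.whiskerLeft_add, MonoidalPreadditive.add_whiskerRight,
          Preadditive.add_comp, Preadditive.comp_add]
        simp only [Iso.trans_hom, Iso.symm_hom, whiskerLeftIso_hom, whiskerRightIso_hom, ← id_tensorHom, ← tensorHom_id, Category.assoc, associator_naturality, associator_naturality_assoc, associator_inv_naturality_assoc, associator_inv_naturality, tensorHom_comp_tensorHom, tensorHom_comp_tensorHom_assoc, BraidedCategory.braiding_naturality, Category.id_comp, Category.comp_id, id_tensorHom_id]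
      · rw [← mk_left _ _ ha]
        refine mk_iso ((α_ a Y X).symm ≪≫ whiskerRightIso (β_ a Y) X) ?_
        simp only [MonoidalPreadditive.whiskerLeft_add, MonoidalPreadditive.add_whiskerRight,
          Preadditive.add_comp, Preadditive.comp_add]
        simp only [Iso.trans_hom, Iso.symm_hom, whiskerLeftIso_hom, whiskerRightIso_hom, ← id_tensorHom, ← tensorHom_id, Category.assoc, associator_naturality, associator_naturality_assoc, associator_inv_naturality_assoc, associator_inv_naturality, tensorHom_comp_tensorHom, tensorHom_comp_tensorHom_assoc, BraidedCategory.braiding_naturality, Category.id_comp, Category.comp_id, id_tensorHom_id])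

lemma mk_add_mk {X Y : K} (hX : Φ.mem X) (hY : Φ.mem Y) {f : X ⟶ X} {g : Y ⟶ Y}
    (hf : IsBalanced f) (hg : IsBalanced g) :
    mk X hX f hf + mk Y hY g hg =
      mk (X ⊗ Y) (Φ.tensor_mem hX hY) (f ▷ Y + X ◁ g)
        ((hf.whiskerRight _).add (hg.whiskerLeft _)) := rfl

noncomputable instance : Zero (R Φ) where
  zero := mk Φ.nonempty.choose Φ.nonempty.choose_spec 0 (IsBalanced.zero _)

lemma zero_eq {X : K} (hX : Φ.mem X) : (0 : R Φ) = mk X hX 0 (IsBalanced.zero X) := by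
  change mk _ Φ.nonempty.choose_spec 0 (IsBalanced.zero _) = _
  rw [← mk_right _ _ hX, ← mk_left hX _ Φ.nonempty.choose_spec]
  exact mk_congr (by simp)

instance : Neg (R Φ) where
  neg := Quot.lift (fun r => mk r.X r.mem (-r.f) r.bal.neg) (by
    rintro _ _ (⟨a, ha, ⟨Y, hY, g, hg⟩⟩ | ⟨a, ha, ⟨Y, hY, g, hg⟩⟩)
    · rw [← mk_left _ _ ha]
      exact mk_congr (tensorLeft a).map_neg
    · rw [← mk_right _ _ ha]
      exact mk_congr (tensorRight a).map_neg)

lemma mk_add_mk' {X : K} (hX : Φ.mem X) {f g : X ⟶ X} (hf : IsBalanced f) (hg : IsBalanced g) :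
    mk X hX f hf + mk X hX g hg = mk X hX (f + g) (hf.add hg) := by
  rw [mk_add_mk, ← mk_right hX (hf.add hg) hX]
  refine mk_congr ?_
  rw [MonoidalPreadditive.add_whiskerRight, show g ▷ X = X ◁ g from hg]

noncomputable instance : CommRing (R Φ) where
  add_assoc r s t := by
    obtain ⟨X, hX, f, g, h, hf, hg, hh, rfl, rfl, rfl⟩ := exists_rep₃ r s t
    simp only [mk_add_mk']
    exact mk_congr (add_assoc _ _ _)
  zero_add r := by
    induction r using ind with | _ X hX f hf
    rw [zero_eq hX, mk_add_mk']
    exact mk_congr (zero_add _)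
  add_zero r := by
    induction r using ind with | _ X hX f hf
    rw [zero_eq hX, mk_add_mk']
    exact mk_congr (add_zero _)
  add_comm r s := by
    obtain ⟨X, hX, f, g, hf, hg, rfl, rfl⟩ := exists_rep₂ r s
    simp only [mk_add_mk']
    exact mk_congr (add_comm _ _)
  neg_add_cancel r := by
    induction r using ind with | _ X hX f hf
    rw [zero_eq hX]
    exact (mk_add_mk' hX hf.neg hf).trans (mk_congr (neg_add_cancel f))
  nsmul := nsmulRec
  zsmul := zsmulRec
  mul_assoc r s t := by
    obtain ⟨X, hX, f, g, h, hf, hg, hh, rfl, rfl, rfl⟩ := exists_rep₃ r s t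
    simp only [mk_mul_mk']
    exact mk_congr (Category.assoc _ _ _)
  one_mul r := by
    induction r using ind with | _ X hX f hf
    rw [one_eq hX, mk_mul_mk']
    exact mk_congr (Category.id_comp _)
  mul_one r := by
    induction r using ind with | _ X hX f hf
    rw [one_eq hX, mk_mul_mk']
    exact mk_congr (Category.comp_id _)
  mul_comm r s := by
    induction r using ind with | _ X hX f hf
    induction s using ind with | _ Y hY g hg
    exact mk_iso (β_ X Y) (BraidedCategory.braiding_naturality f g)
  zero_mul r := by
    induction r using ind with | _ X hX f hf
    rw [zero_eq hX, mk_mul_mk']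
    exact mk_congr Limits.zero_comp
  mul_zero r := by
    induction r using ind with | _ X hX f hf
    rw [zero_eq hX, mk_mul_mk']
    exact mk_congr Limits.comp_zero
  left_distrib r s t := by
    obtain ⟨X, hX, f, g, h, hf, hg, hh, rfl, rfl, rfl⟩ := exists_rep₃ r s t
    simp only [mk_mul_mk', mk_add_mk']
    exact mk_congr (Preadditive.comp_add _ _ _ _ _ _)
  right_distrib r s t := by
    obtain ⟨X, hX, f, g, h, hf, hg, hh, rfl, rfl, rfl⟩ := exists_rep₃ r s t
    simp only [mk_mul_mk', mk_add_mk']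
    exact mk_congr (Preadditive.add_comp _ _ _ _ _ _)


/-- The inclusion `Φ ⊆ Ψ` induces the ring homomorphism `R_Φ → R_Ψ`, `[f] ↦ [f]`. -/
def incl {Φ Ψ : MulSet K} (h : ∀ X, Φ.mem X → Ψ.mem X) : R Φ →+* R Ψ where
  toFun := Quot.lift (fun r => mk r.X (h _ r.mem) r.f r.bal) (by
    rintro _ _ (⟨a, ha, r⟩ | ⟨a, ha, r⟩)
    · exact (mk_left _ _ (h _ ha)).symm
    · exact (mk_right _ _ (h _ ha)).symm)
  map_one' := by
    obtain ⟨X, hX⟩ := Φ.nonempty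
    rw [one_eq hX, one_eq (h X hX)]
    rfl
  map_zero' := by
    obtain ⟨X, hX⟩ := Φ.nonempty
    rw [zero_eq hX, zero_eq (h X hX)]
    rfl
  map_add' r s := by
    induction r using ind with | _ X hX f hf
    induction s using ind with | _ Y hY g hg
    rfl
  map_mul' r s := by
    induction r using ind with | _ X hX f hf
    induction s using ind with | _ Y hY g hg
    rfl

end R

end Ring

/-! ### Functoriality of `R_Φ` -/

section Functor

variable {K : Type u} [Category.{v} K] [MonoidalCategory K]
  {L : Type u'} [Category.{v'} L] [MonoidalCategory L]

open Functor.LaxMonoidal Functor.OplaxMonoidal Functor.Monoidal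

lemma IsBalanced.map (F : K ⥤ L) [F.Monoidal] {X : K} {f : X ⟶ X} (hf : IsBalanced f) :
    IsBalanced (F.map f) := by
  unfold IsBalanced at *
  rw [← cancel_mono (μ F X X), μ_natural_left, μ_natural_right, hf]

/-- The multiplicative set `F(Φ)` of the objects isomorphic to `F(X)` for some `X ∈ Φ`. -/
def MulSet.map (Φ : MulSet K) (F : K ⥤ L) [F.Monoidal] : MulSet L where
  mem := Φ.mem.map F
  nonempty := Φ.nonempty.imp' F.obj fun _ hX => Φ.mem.prop_map_obj F hX
  tensor_mem := by
    rintro X Y ⟨X', hX', ⟨e⟩⟩ ⟨Y', hY', ⟨e'⟩⟩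
    exact ⟨X' ⊗ Y', Φ.tensor_mem hX' hY', ⟨(μIso F X' Y').symm ≪≫ (e ⊗ᵢ e')⟩⟩

lemma MulSet.map_mem (Φ : MulSet K) (F : K ⥤ L) [F.Monoidal] (X : K) (hX : Φ.mem X) :
    (Φ.map F).mem (F.obj X) := Φ.mem.prop_map_obj F hX

variable [SymmetricCategory K] [SymmetricCategory L]
  [Preadditive K] [MonoidalPreadditive K] [Preadditive L] [MonoidalPreadditive L]

/-- If `F(Φ) ⊆ Ψ`, the induced ring homomorphism `R_Φ → R_Ψ`, `[f] ↦ [F(f)]`. -/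
def R.map (F : K ⥤ L) [F.Monoidal] [F.Additive] {Φ : MulSet K} {Ψ : MulSet L}
    (h : ∀ X, Φ.mem X → Ψ.mem (F.obj X)) : R Φ →+* R Ψ where
  toFun := Quot.lift (fun r => R.mk (F.obj r.X) (h _ r.mem) (F.map r.f) (r.bal.map F)) (by
    rintro _ _ (⟨a, ha, ⟨X, hX, f, hf⟩⟩ | ⟨a, ha, ⟨X, hX, f, hf⟩⟩)
    · rw [← R.mk_left _ _ (h _ ha)]
      exact R.mk_iso (μIso F a X) (by simp)
    · rw [← R.mk_right _ _ (h _ ha)]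
      exact R.mk_iso (μIso F X a) (by simp))
  map_one' := by
    obtain ⟨X, hX⟩ := Φ.nonempty
    rw [R.one_eq hX, R.one_eq (h X hX)]
    exact R.mk_congr (F.map_id X)
  map_zero' := by
    obtain ⟨X, hX⟩ := Φ.nonempty
    rw [R.zero_eq hX, R.zero_eq (h X hX)]
    exact R.mk_congr (F.map_zero X X)
  map_add' r s := by
    obtain ⟨X, hX, f, g, hf, hg, rfl, rfl⟩ := R.exists_rep₂ r s
    rw [R.mk_add_mk']
    refine Eq.trans ?_ (R.mk_add_mk' (h X hX) (hf.map F) (hg.map F)).symm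
    exact R.mk_congr F.map_add
  map_mul' r s := by
    obtain ⟨X, hX, f, g, hf, hg, rfl, rfl⟩ := R.exists_rep₂ r s
    rw [R.mk_mul_mk']
    refine Eq.trans ?_ (R.mk_mul_mk' (h X hX) (hf.map F) (hg.map F)).symm
    exact R.mk_congr (F.map_comp f g)

lemma R.map_mk (F : K ⥤ L) [F.Monoidal] [F.Additive] {Φ : MulSet K} {Ψ : MulSet L}
    (h : ∀ X, Φ.mem X → Ψ.mem (F.obj X)) {X : K} (hX : Φ.mem X) {f : X ⟶ X}
    (hf : IsBalanced f) :
    R.map F h (R.mk X hX f hf) = R.mk (F.obj X) (h X hX) (F.map f) (hf.map F) := rfl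

end Functor
/-! ### The spectrum -/

section Spectrum

variable (K : Type u) [Category.{v} K] [Preadditive K] [HasZeroObject K]
  [HasShift K ℤ] [∀ n : ℤ, (shiftFunctor K n).Additive] [Pretriangulated K]
  [MonoidalCategory K]

/-- A prime of `K`: a proper thick `⊗`-ideal `𝒫` such that `a ⊗ b ∈ 𝒫` implies `a ∈ 𝒫` or
`b ∈ 𝒫`. (Thick: a triangulated subcategory closed under direct summands.) -/
structure Spc where
  mem : ObjectProperty K
  isTriangulated : mem.IsTriangulated
  isStableUnderRetracts : mem.IsStableUnderRetracts
  tensor_mem : ∀ (a : K) {b : K}, mem b → mem (a ⊗ b)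
  proper : ∃ a, ¬ mem a
  prime : ∀ {a b : K}, mem (a ⊗ b) → mem a ∨ mem b

variable {K}

attribute [instance] Spc.isTriangulated Spc.isStableUnderRetracts

/-- The support `supp(a) = {𝒫 | a ∉ 𝒫}`. -/
def supp (a : K) : Set (Spc K) := {P | ¬ P.mem a}

/-- The topology on `Spc(K)` for which the sets `supp(a)` form a basis of closed sets. -/
instance : TopologicalSpace (Spc K) :=
  TopologicalSpace.generateFrom (Set.range fun a : K => (supp a)ᶜ)

lemma Spc.tensor_mem_iff [BraidedCategory K] (P : Spc K) {a b : K} :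
    P.mem (a ⊗ b) ↔ P.mem a ∨ P.mem b :=
  ⟨P.prime, fun h => h.elim (fun h => P.mem.prop_of_iso (β_ b a) (P.tensor_mem b h))
    (fun h => P.tensor_mem a h)⟩

lemma supp_tensor [BraidedCategory K] (a b : K) : supp (a ⊗ b) = supp a ∩ supp b := by
  ext P
  simp [supp, P.tensor_mem_iff]

lemma supp_unit : supp (𝟙_ K) = Set.univ := by
  ext P
  refine iff_of_true (fun h => ?_) (Set.mem_univ _)
  obtain ⟨a, ha⟩ := P.proper
  exact ha (P.mem.prop_of_iso (ρ_ a) (P.tensor_mem a h))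

/-- `𝒵_Φ = ⋂_{X ∈ Φ} supp(X)`. -/
def MulSet.Z (Φ : MulSet K) : Set (Spc K) := ⋂ (X : K) (_ : Φ.mem X), supp X

lemma MulSet.not_mem_of_mem_Z {Φ : MulSet K} {P : Spc K} (hP : P ∈ Φ.Z) {X : K}
    (hX : Φ.mem X) : ¬ P.mem X :=
  Set.mem_iInter₂.1 hP X hX

/-- `cone(f) ∈ 𝒫`. -/
def Spc.ConeMem (P : Spc K) {X Y : K} (f : X ⟶ Y) : Prop := P.mem.trW f

lemma Spc.coneMem_iff (P : Spc K) {X Y Z : K} {f : X ⟶ Y} {g : Y ⟶ Z} {h : Z ⟶ X⟦(1 : ℤ)⟧}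
    (hT : Triangle.mk f g h ∈ distTriang K) : P.ConeMem f ↔ P.mem Z :=
  P.mem.trW_iff_of_distinguished _ hT

end Spectrum

/-! ### The comparison map `ρ_Φ` -/

section Rho

variable {K : Type u} [Category.{v} K] [Preadditive K] [HasZeroObject K]
  [HasShift K ℤ] [∀ n : ℤ, (shiftFunctor K n).Additive] [Pretriangulated K] [IsTriangulated K]
  [MonoidalCategory K] [MonoidalPreadditive K] [SymmetricCategory K] [TensorTriangulated K]

lemma Spc.coneMem_whiskerLeft (P : Spc K) (a : K) {X Y : K} (f : X ⟶ Y) :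
    P.ConeMem (a ◁ f) ↔ P.mem a ∨ P.ConeMem f := by
  obtain ⟨Z, g, h, hT⟩ := distinguished_cocone_triangle f
  rw [P.coneMem_iff hT]
  exact (P.coneMem_iff ((tensorLeft a).map_distinguished _ hT)).trans P.tensor_mem_iff

lemma Spc.coneMem_whiskerRight (P : Spc K) (a : K) {X Y : K} (f : X ⟶ Y) :
    P.ConeMem (f ▷ a) ↔ P.mem a ∨ P.ConeMem f := by
  obtain ⟨Z, g, h, hT⟩ := distinguished_cocone_triangle f
  rw [P.coneMem_iff hT]
  exact (P.coneMem_iff ((tensorRight a).map_distinguished _ hT)).trans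
    (P.tensor_mem_iff.trans or_comm)

lemma Spc.coneMem_comp (P : Spc K) {X Y Z : K} {f : X ⟶ Y} {g : Y ⟶ Z} (hf : P.ConeMem f)
    (hg : P.ConeMem g) : P.ConeMem (f ≫ g) := P.mem.trW.comp_mem f g hf hg

lemma Spc.mem_of_coneMem_zero (P : Spc K) {X : K} (h : P.ConeMem (0 : X ⟶ X)) : P.mem X := by
  obtain ⟨Z, g, k, hT, hZ⟩ := h
  obtain ⟨r, hr⟩ := Triangle.yoneda_exact₂ _ hT (𝟙 X) Limits.zero_comp
  exact P.mem.prop_of_retract ⟨g, r, hr.symm⟩ hZ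

/-- If `f` is balanced then `f ⊗ ΣX = X ⊗ Σf`. -/
lemma IsBalanced.whiskerRight_shift {X : K} {f : X ⟶ X} (hf : IsBalanced f) :
    f ▷ (X⟦(1 : ℤ)⟧) = X ◁ (f⟦(1 : ℤ)⟧') := by
  have h1 := NatTrans.shift_app_comm ((curriedTensor K).map f) (1 : ℤ) X
  have h2 := ((tensorLeft X).commShiftIso (1 : ℤ)).hom.naturality f
  rw [← cancel_mono (((tensorLeft X).commShiftIso (1 : ℤ)).hom.app X)]
  refine h1.symm.trans ?_
  refine Eq.trans ?_ h2.symm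
  exact congrArg (fun t => ((tensorLeft X).commShiftIso (1 : ℤ)).hom.app X ≫ t⟦(1 : ℤ)⟧') hf

/-- A balanced endomorphism squares to zero on its own cone. -/
lemma IsBalanced.comp_whiskerRight_cone {X C : K} {f : X ⟶ X} (hf : IsBalanced f)
    {g : X ⟶ C} {h : C ⟶ X⟦(1 : ℤ)⟧} (hT : Triangle.mk f g h ∈ distTriang K) :
    (f ≫ f) ▷ C = 0 := by
  have hT' := (tensorLeft X).map_distinguished _ hT
  have h1 : X ◁ g ≫ f ▷ C = 0 := by
    rw [whisker_exchange, show f ▷ X = X ◁ f from hf, ← whiskerLeft_comp]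
    have : f ≫ g = 0 := comp_distTriang_mor_zero₁₂ _ hT
    simp [this]
  have h2 : f ▷ C ≫ X ◁ h = 0 := by
    rw [← whisker_exchange, hf.whiskerRight_shift, ← whiskerLeft_comp]
    have : h ≫ f⟦(1 : ℤ)⟧' = 0 := comp_distTriang_mor_zero₃₁ _ hT
    simp [this]
  have h3 : f ▷ C ≫ X ◁ h ≫ ((tensorLeft X).commShiftIso (1 : ℤ)).hom.app X = 0 := by
    rw [reassoc_of% h2, Limits.zero_comp]
  obtain ⟨l, hl⟩ : ∃ l : X ⊗ C ⟶ X ⊗ X, f ▷ C = l ≫ X ◁ g :=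
    Triangle.coyoneda_exact₃ _ hT' (f ▷ C) h3
  rw [comp_whiskerRight]
  nth_rewrite 1 [hl]
  rw [Category.assoc, h1, Limits.comp_zero]

lemma whiskerRight_tensor_eq_zero {V A : K} {u : V ⟶ V} (h : u ▷ A = 0) (B : K) :
    u ▷ (A ⊗ B) = 0 := by
  rw [MonoidalCategory.whiskerRight_tensor, h]
  simp

lemma whiskerRight_tensor_eq_zero' {V A : K} {u : V ⟶ V} (h : u ▷ A = 0) (B : K) :
    u ▷ (B ⊗ A) = 0 := by
  have := whiskerRight_tensor_eq_zero h B
  rw [← cancel_epi (V ◁ (β_ A B).hom), whisker_exchange, this]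
  simp

lemma whiskerLeft_whiskerRight_eq_zero {V A : K} {u : V ⟶ V} (h : u ▷ A = 0) (B : K) :
    (B ◁ u) ▷ A = 0 := by
  rw [whisker_assoc, h]
  simp

/-- If `f`, `g` are balanced endomorphisms of `X ∉ 𝒫` and `p` is in the ideal generated by `f²`
and `g²` on `X ⊗ X`, then `cone(p) ∈ 𝒫` implies `cone(f) ∈ 𝒫` or `cone(g) ∈ 𝒫`. -/
lemma Spc.coneMem_or (P : Spc K) {X : K} (hX : ¬ P.mem X) {f g : X ⟶ X} (hf : IsBalanced f)
    (hg : IsBalanced g) {p : X ⊗ X ⟶ X ⊗ X} (a b : X ⊗ X ⟶ X ⊗ X)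
    (hp : p = X ◁ (f ≫ f) ≫ a + X ◁ (g ≫ g) ≫ b) (h : P.ConeMem p) :
    P.ConeMem f ∨ P.ConeMem g := by
  obtain ⟨C, f', f'', hC⟩ := distinguished_cocone_triangle f
  obtain ⟨D, g', g'', hD⟩ := distinguished_cocone_triangle g
  rw [P.coneMem_iff hC, P.coneMem_iff hD]
  have h1 := whiskerRight_tensor_eq_zero
    (whiskerLeft_whiskerRight_eq_zero (hf.comp_whiskerRight_cone hC) X) D
  have h2 := whiskerRight_tensor_eq_zero'
    (whiskerLeft_whiskerRight_eq_zero (hg.comp_whiskerRight_cone hD) X) C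
  have h0 : p ▷ (C ⊗ D) = 0 := by
    rw [hp, MonoidalPreadditive.add_whiskerRight, comp_whiskerRight, comp_whiskerRight, h1, h2]
    simp
  have h3 := (P.coneMem_whiskerRight (C ⊗ D) p).2 (Or.inr h)
  rw [h0] at h3
  have h4 := P.mem_of_coneMem_zero h3
  simp only [P.tensor_mem_iff] at h4
  tauto

lemma Spc.coneMem_add (P : Spc K) {X : K} (hX : ¬ P.mem X) {f g : X ⟶ X} (hf : IsBalanced f)
    (hg : IsBalanced g) (h : P.ConeMem (f + g)) : P.ConeMem f ∨ P.ConeMem g := by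
  have h1 : P.ConeMem (X ◁ (f + g)) := (P.coneMem_whiskerLeft X _).2 (Or.inr h)
  have hc : X ◁ f ≫ X ◁ g = X ◁ g ≫ X ◁ f := by
    rw [← show f ▷ X = X ◁ f from hf]
    exact (whisker_exchange f g).symm
  have h3 := P.coneMem_comp (P.coneMem_comp h1 h1) h1
  refine P.coneMem_or hX hf hg (X ◁ f + X ◁ g + X ◁ g + X ◁ g)
    (X ◁ f + X ◁ f + X ◁ f + X ◁ g) ?_ h3
  simp only [MonoidalPreadditive.whiskerLeft_add, whiskerLeft_comp, Preadditive.add_comp,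
    Preadditive.comp_add, Category.assoc, ← hc]
  have e1 : X ◁ g ≫ X ◁ f ≫ X ◁ f = X ◁ f ≫ X ◁ f ≫ X ◁ g := by
    rw [← reassoc_of% hc, ← hc]
  have e2 : X ◁ g ≫ X ◁ f ≫ X ◁ g = X ◁ g ≫ X ◁ g ≫ X ◁ f := by rw [hc]
  have e3 : X ◁ f ≫ X ◁ g ≫ X ◁ g = X ◁ g ≫ X ◁ g ≫ X ◁ f := by
    rw [reassoc_of% hc, hc]
  have e4 : X ◁ f ≫ X ◁ g ≫ X ◁ f = X ◁ f ≫ X ◁ f ≫ X ◁ g := by rw [← hc]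
  simp only [hc, e1, e2, e3, e4]
  abel

lemma Spc.coneMem_of_comp (P : Spc K) {X : K} (hX : ¬ P.mem X) {f g : X ⟶ X}
    (hf : IsBalanced f) (h : P.ConeMem (f ≫ g)) : P.ConeMem f := by
  have h1 : P.ConeMem (X ◁ (f ≫ g)) := (P.coneMem_whiskerLeft X _).2 (Or.inr h)
  have hc : X ◁ f ≫ X ◁ g = X ◁ g ≫ X ◁ f := by
    rw [← show f ▷ X = X ◁ f from hf]
    exact (whisker_exchange f g).symm
  have h2 := P.coneMem_comp h1 h1
  refine (or_self_iff.1 (P.coneMem_or hX hf hf (X ◁ (g ≫ g)) 0 ?_ h2))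
  simp only [whiskerLeft_comp, Category.assoc, Limits.comp_zero, add_zero]
  rw [← reassoc_of% hc]

/-- Whether `cone(f) ∈ 𝒫` only depends on `[f] ∈ R_Φ` if `𝒫 ∈ 𝒵_Φ`. -/
lemma R.coneMem_congr {Φ : MulSet K} {P : Spc K} (hP : P ∈ Φ.Z) {X Y : K} {hX : Φ.mem X}
    {hY : Φ.mem Y} {f : X ⟶ X} {g : Y ⟶ Y} {hf : IsBalanced f} {hg : IsBalanced g}
    (h : R.mk X hX f hf = R.mk Y hY g hg) : P.ConeMem f ↔ P.ConeMem g := by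
  let t : R Φ → Prop := Quot.lift (fun r => P.ConeMem r.f) (by
    rintro _ _ (⟨a, ha, r⟩ | ⟨a, ha, r⟩)
    · simp [P.coneMem_whiskerLeft, MulSet.not_mem_of_mem_Z hP ha]
    · simp [P.coneMem_whiskerRight, MulSet.not_mem_of_mem_Z hP ha])
  exact iff_of_eq (congrArg t h)

/-- The set `ρ_Φ(𝒫) = {[f] ∈ R_Φ | cone(f) ∉ 𝒫}`. -/
def rhoSet (Φ : MulSet K) (P : Spc K) : Set (R Φ) :=
  {r | ∃ (X : K) (hX : Φ.mem X) (f : X ⟶ X) (hf : IsBalanced f),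
    r = R.mk X hX f hf ∧ ¬ P.ConeMem f}

lemma mk_mem_rhoSet {Φ : MulSet K} {P : Spc K} (hP : P ∈ Φ.Z) {X : K} (hX : Φ.mem X)
    {f : X ⟶ X} (hf : IsBalanced f) : R.mk X hX f hf ∈ rhoSet Φ P ↔ ¬ P.ConeMem f := by
  refine ⟨?_, fun h => ⟨X, hX, f, hf, rfl, h⟩⟩
  rintro ⟨Y, hY, g, hg, h, hn⟩
  rwa [R.coneMem_congr hP h]

/-- The comparison map `ρ_Φ : 𝒵_Φ → Spec(R_Φ)`, `𝒫 ↦ {[f] ∈ R_Φ | cone(f) ∉ 𝒫}`. -/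
noncomputable def rho (Φ : MulSet K) (P : Φ.Z) : PrimeSpectrum (R Φ) where
  asIdeal :=
    { carrier := rhoSet Φ P
      add_mem' := by
        intro r s hr hs
        obtain ⟨X, hX, f, g, hf, hg, rfl, rfl⟩ := R.exists_rep₂ r s
        rw [R.mk_add_mk', mk_mem_rhoSet P.2]
        rw [mk_mem_rhoSet P.2] at hr hs
        intro h
        have := P.1.coneMem_add (MulSet.not_mem_of_mem_Z P.2 hX) hf hg h
        tauto
      zero_mem' := by
        obtain ⟨X, hX⟩ := Φ.nonempty
        rw [R.zero_eq hX, mk_mem_rhoSet P.2]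
        exact fun h => MulSet.not_mem_of_mem_Z P.2 hX (P.1.mem_of_coneMem_zero h)
      smul_mem' := by
        intro r s hs
        rw [smul_eq_mul, mul_comm]
        obtain ⟨X, hX, f, g, hf, hg, rfl, rfl⟩ := R.exists_rep₂ r s
        rw [R.mk_mul_mk', mk_mem_rhoSet P.2]
        rw [mk_mem_rhoSet P.2] at hs
        exact fun h => hs (P.1.coneMem_of_comp (MulSet.not_mem_of_mem_Z P.2 hX) hg h) }
  isPrime := by
    refine Ideal.isPrime_iff.2 ⟨?_, ?_⟩
    · rw [Ideal.ne_top_iff_one]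
      obtain ⟨X, hX⟩ := Φ.nonempty
      change ¬ ((1 : R Φ) ∈ rhoSet Φ P)
      rw [R.one_eq hX, mk_mem_rhoSet P.2, not_not]
      exact P.1.mem.trW.id_mem X
    · intro r s h
      obtain ⟨X, hX, f, g, hf, hg, rfl, rfl⟩ := R.exists_rep₂ r s
      change _ ∈ rhoSet Φ P at h
      change _ ∈ rhoSet Φ P ∨ _ ∈ rhoSet Φ P
      rw [R.mk_mul_mk', mk_mem_rhoSet P.2] at h
      rw [mk_mem_rhoSet P.2, mk_mem_rhoSet P.2]
      by_contra! hn
      exact h (P.1.coneMem_comp hn.1 hn.2)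

end Rho

/-! ### Object and closed set comparison maps -/

section ObjectClosed

variable {K : Type u} [Category.{v} K] [MonoidalCategory K]

/-- `tensorPow X n` is the tensor power `X^{⊗(n+1)}`. -/
def tensorPow (X : K) : ℕ → K
  | 0 => X
  | n + 1 => tensorPow X n ⊗ X

lemma tensorPow_add (X : K) (m n : ℕ) :
    Nonempty (tensorPow X m ⊗ tensorPow X n ≅ tensorPow X (m + n + 1)) := by
  induction n with
  | zero => exact ⟨Iso.refl _⟩
  | succ n ih =>
    obtain ⟨e⟩ := ih
    exact ⟨(α_ _ _ _).symm ≪≫ (e ⊗ᵢ Iso.refl X)⟩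

/-- The multiplicative set of the tensor powers `X^{⊗n}`, `n ≥ 1` (up to isomorphism). -/
def objectSet (X : K) : MulSet K where
  mem Y := ∃ n : ℕ, Nonempty (Y ≅ tensorPow X n)
  nonempty := ⟨X, 0, ⟨Iso.refl _⟩⟩
  tensor_mem := by
    rintro Y Y' ⟨m, ⟨e⟩⟩ ⟨n, ⟨e'⟩⟩
    obtain ⟨e''⟩ := tensorPow_add X m n
    exact ⟨m + n + 1, ⟨(e ⊗ᵢ e') ≪≫ e''⟩⟩

lemma objectSet_mem_self (X : K) : (objectSet X).mem X := ⟨0, ⟨Iso.refl _⟩⟩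

variable [Preadditive K] [HasZeroObject K]
  [HasShift K ℤ] [∀ n : ℤ, (shiftFunctor K n).Additive] [Pretriangulated K] [SymmetricCategory K]

lemma objectSet_Z (X : K) : (objectSet X).Z = supp X := by
  refine Set.Subset.antisymm (fun P hP => Set.mem_iInter₂.1 hP X (objectSet_mem_self X)) ?_
  intro P hP
  refine Set.mem_iInter₂.2 ?_
  rintro Y ⟨n, ⟨e⟩⟩ hY
  have h : P.mem (tensorPow X n) := P.mem.prop_of_iso e hY
  clear e hY
  induction n with
  | zero => exact hP h
  | succ n ih => exact (P.prime h).elim ih hP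

/-- For `𝒵 ⊆ Spc(K)`, the multiplicative set `{a | supp(a) ⊇ 𝒵}`. -/
def closedSet (Z : Set (Spc K)) : MulSet K where
  mem a := Z ⊆ supp a
  nonempty := ⟨𝟙_ K, by rw [supp_unit]; exact Set.subset_univ _⟩
  tensor_mem ha hb := by rw [supp_tensor]; exact Set.subset_inter ha hb

lemma subset_closedSet_Z (Z : Set (Spc K)) : Z ⊆ (closedSet Z).Z :=
  Set.subset_iInter₂ fun _ h => h

variable [IsTriangulated K] [MonoidalPreadditive K] [TensorTriangulated K]

/-- The object comparison map `ρ_X : supp(X) → Spec(R_X)`. -/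
noncomputable def objectRho (X : K) (P : supp X) : PrimeSpectrum (R (objectSet X)) :=
  rho (objectSet X) ⟨P, (objectSet_Z X).ge P.2⟩

/-- The closed set comparison map `ρ_𝒵 : 𝒵 → Spec(R_𝒵)`. -/
noncomputable def closedRho (Z : Set (Spc K)) (P : Z) : PrimeSpectrum (R (closedSet Z)) :=
  rho (closedSet Z) ⟨P, subset_closedSet_Z Z P.2⟩

end ObjectClosed

/-! ### Morphisms of tensor triangulated categories and idempotent completion -/

section Morphism

variable {K : Type u} [Category.{v} K] [Preadditive K] [HasZeroObject K]
  [HasShift K ℤ] [∀ n : ℤ, (shiftFunctor K n).Additive] [Pretriangulated K] [IsTriangulated K]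
  [MonoidalCategory K] [MonoidalPreadditive K] [SymmetricCategory K] [TensorTriangulated K]
  {L : Type u'} [Category.{v'} L] [Preadditive L] [HasZeroObject L]
  [HasShift L ℤ] [∀ n : ℤ, (shiftFunctor L n).Additive] [Pretriangulated L] [IsTriangulated L]
  [MonoidalCategory L] [MonoidalPreadditive L] [SymmetricCategory L] [TensorTriangulated L]

open Functor.LaxMonoidal

/-- A morphism of tensor triangulated categories: an exact functor `F` that is a strong symmetric
`⊗`-functor, such that the isomorphisms `F Σa ≅ Σ Fa` and `Fa ⊗ Fb ≅ F(a ⊗ b)` are compatible with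
the suspension isomorphisms `Σa ⊗ b ≅ Σ(a ⊗ b)` of both categories. -/
class IsTensorTriangulatedFunctor (F : K ⥤ L) [F.CommShift ℤ] [F.Braided] : Prop
    extends F.IsTriangulated where
  shift_μ (a b : K) (n : ℤ) :
    (F.commShiftIso n).hom.app a ▷ F.obj b ≫
        ((tensorRight (F.obj b)).commShiftIso n).hom.app (F.obj a) ≫ (μ F a b)⟦n⟧' =
      μ F (a⟦n⟧) b ≫ F.map (((tensorRight b).commShiftIso n).hom.app a) ≫
        (F.commShiftIso n).hom.app (a ⊗ b)

/-- The map `F^* : Spc(L) → Spc(K)`, `𝒬 ↦ F⁻¹(𝒬)`. -/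
def Spc.comap (F : K ⥤ L) [F.CommShift ℤ] [F.Braided] [F.IsTriangulated] (Q : Spc L) :
    Spc K where
  mem := Q.mem.inverseImage F
  isTriangulated := inferInstance
  isStableUnderRetracts := ⟨fun h hY => Q.mem.prop_of_retract (h.map F) hY⟩
  tensor_mem a b hb := Q.mem.prop_of_iso (Functor.Monoidal.μIso F a b) (Q.tensor_mem _ hb)
  proper := by
    by_contra! h
    obtain ⟨a, ha⟩ := Q.proper
    have h1 : Q.mem (𝟙_ L) := Q.mem.prop_of_iso (Functor.Monoidal.εIso F).symm (h (𝟙_ K))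
    exact ha (Q.mem.prop_of_iso (ρ_ a) (Q.tensor_mem a h1))
  prime {a b} h := Q.prime (Q.mem.prop_of_iso (Functor.Monoidal.μIso F a b).symm h)

lemma Spc.comap_preimage_supp (F : K ⥤ L) [F.CommShift ℤ] [F.Braided] [F.IsTriangulated]
    (a : K) : Spc.comap F ⁻¹' supp a = supp (F.obj a) := rfl

lemma closedSet_map (F : K ⥤ L) [F.CommShift ℤ] [F.Braided] [F.IsTriangulated]
    (Z : Set (Spc K)) (a : K) (ha : (closedSet Z).mem a) :
    (closedSet (Spc.comap F ⁻¹' Z)).mem (F.obj a) := fun _ hQ => ha hQ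

end Morphism

section Idempotent

variable {K : Type u} [Category.{v} K] {L : Type u'} [Category.{v'} L]

/-- `i : K ⥤ L` exhibits `L` as an idempotent completion of `K`: every idempotent of `L` splits,
`i` is fully faithful, and every object of `L` is a direct summand of an object of `i(K)`. -/
structure IsIdempotentCompletion (i : K ⥤ L) : Prop where
  full : i.Full
  faithful : i.Faithful
  isIdempotentComplete : IsIdempotentComplete L
  exists_retract : ∀ X : L, ∃ A : K, Nonempty (Retract X (i.obj A))

/-- The usual construction of the idempotent completion, by formally splitting all idempotents,
is one. -/
lemma isIdempotentCompletion_toKaroubi (K : Type u) [Category.{v} K] :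
    IsIdempotentCompletion (Idempotents.toKaroubi K) where
  full := inferInstance
  faithful := inferInstance
  isIdempotentComplete := inferInstance
  exists_retract X := ⟨X.X, ⟨X.decompId_i, X.decompId_p, X.decompId.symm⟩⟩

end Idempotent

end TTGeom

open TTGeom

/-! The proof rests on two mechanisms. The first moves classes between objects. If `f` on `A` and
`g` on `B` satisfy `f ⊗ B = A ⊗ g` (`Twin`), then `f` and `g` have the same class in every `R Φ`
with `A, B ∈ Φ`, since both classes are represented by the same endomorphism of `A ⊗ B`. For fixed
`f`, the relation survives isomorphisms, compression of `g` to a direct summand, suspension and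
direct sums. Hence `[f]` on `W` is also represented by its compression to any summand of `W`, and by
`f ⊕ Σf` on `W ⊕ ΣW`, as long as these objects lie in `Φ`. The case `g = 0` says that the objects
`B` with `f ⊗ B = 0` are closed under the same operations. By `R.mk_eq_zero_iff`, a class `[f]`
vanishes exactly when `f ⊗ a = 0` for some `a ∈ Φ`, so injectivity and surjectivity of maps between
the rings have the same source.

The second mechanism brings objects of the completion `L` back to `K`. If `X` is a summand of
`i(A)`, the complementary projector of `i(A)` comes from an endomorphism of `A`, and its cone,
formed in `K`, becomes `X ⊕ ΣX` in `L`. A thick subcategory contains `X` if and only if it contains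
`X ⊕ ΣX`, so primes and supports in `L` are determined by objects of `K`. This gives the
homeomorphism of spectra, and with the first mechanism the statement for closed subsets.

For a single object `X` with `i(Y) ≅ X ⊕ ΣX`, there is no evident map between the rings of `X` and
`Y`. Both map to the ring of `retractSet X`, the objects that have some tensor power of `X` as a
summand, and both maps are bijective. The isomorphism is the resulting zigzag. Its compatibilities
hold because corresponding classes become equal there, and the class of an endomorphism decides
whether its cone lies in a prime of `𝒵_Φ`. -/

namespace TTGeom

/-! ### Pairs of endomorphisms `f`, `g` with `f ⊗ B = A ⊗ g` -/

section Twin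

variable {K : Type u} [Category.{v} K] [MonoidalCategory K]

/-- Endomorphisms `f` of `A` and `g` of `B` are twins if `f ⊗ B = A ⊗ g` on `A ⊗ B`. -/
def Twin {A B : K} (f : A ⟶ A) (g : B ⟶ B) : Prop := f ▷ B = A ◁ g

lemma IsBalanced.twin {A : K} {f : A ⟶ A} (hf : IsBalanced f) : Twin f f := hf

lemma Twin.symm [BraidedCategory K] {A B : K} {f : A ⟶ A} {g : B ⟶ B} (h : Twin f g) :
    Twin g f := by
  unfold Twin at *
  rw [← cancel_mono (β_ B A).hom, BraidedCategory.braiding_naturality_left,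
    BraidedCategory.braiding_naturality_right, h]

lemma Twin.of_iso {A B C : K} {f : A ⟶ A} {g : B ⟶ B} (h : Twin f g) (e : C ≅ B) :
    Twin f (e.hom ≫ g ≫ e.inv) := by
  unfold Twin at *
  simp only [whiskerLeft_comp, ← h]
  rw [← whisker_exchange, ← whiskerLeft_comp_assoc]
  simp

/-- After replacing `A ⊗ g` by `f ⊗ B`, the interchange law moves `f` past `A ⊗ e.i`, and `e.i ≫ e.r
= 𝟙` remains. In particular `g` need not commute with the projector `e.r ≫ e.i`. -/
lemma Twin.of_retract {A B C : K} {f : A ⟶ A} {g : B ⟶ B} (h : Twin f g) (e : Retract C B) :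
    Twin f (e.i ≫ g ≫ e.r) := by
  unfold Twin at *
  simp only [whiskerLeft_comp, ← h]
  rw [← whisker_exchange, ← whiskerLeft_comp_assoc]
  simp

/-- The compression of a balanced endomorphism to a direct summand is balanced. -/
lemma IsBalanced.of_retract [BraidedCategory K] {V W : K} {f : W ⟶ W} (hf : IsBalanced f)
    (e : Retract V W) : IsBalanced (e.i ≫ f ≫ e.r) :=
  (hf.twin.of_retract e).symm.of_retract e

variable [Preadditive K] [MonoidalPreadditive K]

/-- Through this equivalence each closure property of `Twin` becomes a closure property of the
objects annihilated by `f`. -/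
lemma twin_zero_iff {A B : K} {f : A ⟶ A} : Twin f (0 : B ⟶ B) ↔ f ▷ B = 0 := by
  simp [Twin]

lemma whiskerRight_eq_zero_of_retract {A V W : K} {f : A ⟶ A} (h : f ▷ W = 0)
    (e : Retract V W) : f ▷ V = 0 := by
  have h' := (twin_zero_iff.2 h).of_retract e
  rwa [zero_comp, comp_zero, twin_zero_iff] at h'

lemma Twin.biprod [HasBinaryBiproducts K] {A B C : K} {f : A ⟶ A} {g : B ⟶ B} {h : C ⟶ C}
    (hg : Twin f g) (hh : Twin f h) : Twin f (biprod.map g h) := by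
  unfold Twin at *
  -- Since `A ⊗ -` is additive, an endomorphism of `A ⊗ (B ⊕ C)` is determined by its restrictions
  -- along the two tensored inclusions.
  have e (φ : A ⊗ (B ⊞ C) ⟶ A ⊗ (B ⊞ C)) :
      φ = A ◁ biprod.fst ≫ A ◁ biprod.inl ≫ φ + A ◁ biprod.snd ≫ A ◁ biprod.inr ≫ φ := by
    rw [← whiskerLeft_comp_assoc, ← whiskerLeft_comp_assoc, ← Preadditive.add_comp,
      ← MonoidalPreadditive.whiskerLeft_add, biprod.total]
    simp
  rw [e (f ▷ _), e (A ◁ _)]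
  congr 2
  · rw [whisker_exchange, ← whiskerLeft_comp, biprod.inl_map, whiskerLeft_comp, hg]
  · rw [whisker_exchange, ← whiskerLeft_comp, biprod.inr_map, whiskerLeft_comp, hh]

end Twin

/-! ### Twins and suspension -/

section TwinShift

variable {K : Type u} [Category.{v} K] [Preadditive K] [HasZeroObject K]
  [HasShift K ℤ] [∀ n : ℤ, (shiftFunctor K n).Additive] [Pretriangulated K] [IsTriangulated K]
  [MonoidalCategory K] [MonoidalPreadditive K] [SymmetricCategory K] [TensorTriangulated K]

/-- The isomorphism `A ⊗ ΣB ≅ Σ(A ⊗ B)` is natural in `A`, which turns `f ⊗ ΣB` into `Σ(f ⊗ B)`, and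
in `B`, which turns `A ⊗ Σg` into `Σ(A ⊗ g)`. -/
lemma Twin.shift {A B : K} {f : A ⟶ A} {g : B ⟶ B} (h : Twin f g) :
    Twin f (g⟦(1 : ℤ)⟧') := by
  have h1 := NatTrans.shift_app_comm ((curriedTensor K).map f) (1 : ℤ) B
  have h2 := ((tensorLeft A).commShiftIso (1 : ℤ)).hom.naturality g
  unfold Twin
  rw [← cancel_mono (((tensorLeft A).commShiftIso (1 : ℤ)).hom.app B)]
  refine h1.symm.trans ?_
  refine Eq.trans ?_ h2.symm
  exact congrArg (fun t => ((tensorLeft A).commShiftIso (1 : ℤ)).hom.app B ≫ t⟦(1 : ℤ)⟧') h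

lemma Twin.biprod_shift {A B C : K} {f : A ⟶ A} {g : B ⟶ B} (h : Twin f g)
    (α : C ≅ B ⊞ B⟦(1 : ℤ)⟧) :
    Twin f (α.hom ≫ biprod.map g (g⟦(1 : ℤ)⟧') ≫ α.inv) :=
  (h.biprod h.shift).of_iso α

/-- The twin construction is applied once in each variable, with the symmetry of the relation in
between. -/
lemma IsBalanced.biprod_shift {B C : K} {g : B ⟶ B} (h : IsBalanced g)
    (α : C ≅ B ⊞ B⟦(1 : ℤ)⟧) :
    IsBalanced (α.hom ≫ biprod.map g (g⟦(1 : ℤ)⟧') ≫ α.inv) :=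
  (h.twin.biprod_shift α).symm.biprod_shift α

lemma whiskerRight_eq_zero_of_biprod_shift {A B C : K} {f : A ⟶ A} (h : f ▷ B = 0)
    (α : C ≅ B ⊞ B⟦(1 : ℤ)⟧) : f ▷ C = 0 := by
  have h' : biprod.map (0 : B ⟶ B) ((0 : B ⟶ B)⟦(1 : ℤ)⟧') = 0 := by
    rw [Functor.map_zero]; ext <;> simp
  have := (twin_zero_iff.2 h).biprod_shift α
  rwa [h', zero_comp, comp_zero, twin_zero_iff] at this

end TwinShift

/-! ### Equality in `R_Φ` -/

section Equality

variable {K : Type u} [Category.{v} K] [MonoidalCategory K] [SymmetricCategory K]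

lemma R.mk_eq_mk_of_twin {Φ : MulSet K} {A B : K} {hA : Φ.mem A} {hB : Φ.mem B} {f : A ⟶ A}
    {g : B ⟶ B} {hf : IsBalanced f} {hg : IsBalanced g} (h : Twin f g) :
    R.mk A hA f hf = R.mk B hB g hg := by
  rw [← mk_right hA hf hB, ← mk_left hB hg hA]
  exact mk_congr h

variable [Preadditive K] [MonoidalPreadditive K]

lemma whiskerRight_tensor_eq_zero_iff {A B C : K} {f : A ⟶ A} :
    f ▷ (B ⊗ C) = 0 ↔ (f ▷ B) ▷ C = 0 := by
  rw [MonoidalCategory.whiskerRight_tensor, Preadditive.IsIso.comp_left_eq_zero,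
    Preadditive.IsIso.comp_right_eq_zero]

/-- Being annihilated by some object of `Φ` is invariant under both generating relations, up to
enlarging the object by a tensor factor. It therefore descends to the quotient and holds for every
representative of zero. -/
lemma R.mk_eq_zero_iff {Φ : MulSet K} {A : K} {hA : Φ.mem A} {f : A ⟶ A} {hf : IsBalanced f} :
    R.mk A hA f hf = 0 ↔ ∃ a, Φ.mem a ∧ f ▷ a = 0 := by
  constructor
  · intro h
    let t : R Φ → Prop := Quot.lift (fun r => ∃ a, Φ.mem a ∧ r.f ▷ a = 0) (by
      rintro _ _ (⟨a, ha, ⟨X, hX, g, hg⟩⟩ | ⟨a, ha, ⟨X, hX, g, hg⟩⟩)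
      · refine propext ⟨?_, ?_⟩
        · rintro ⟨b, hb, h⟩
          exact ⟨b, hb, by simp [whisker_assoc, h]⟩
        · rintro ⟨b, hb, h⟩
          refine ⟨a ⊗ b, Φ.tensor_mem ha hb, whiskerRight_tensor_eq_zero_iff.2 ?_⟩
          rw [← cancel_mono ((β_ X a).hom ▷ b), ← comp_whiskerRight,
            BraidedCategory.braiding_naturality_left, comp_whiskerRight, h]
          simp
      · refine propext ⟨?_, ?_⟩
        · rintro ⟨b, hb, h⟩
          refine ⟨b, hb, whiskerRight_tensor_eq_zero_iff.1 ?_⟩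
          refine whiskerRight_eq_zero_of_retract (W := b ⊗ a) ?_ (Retract.ofIso (β_ a b))
          simp [MonoidalCategory.whiskerRight_tensor, h]
        · rintro ⟨b, hb, h⟩
          exact ⟨a ⊗ b, Φ.tensor_mem ha hb, whiskerRight_tensor_eq_zero_iff.2 h⟩)
    have h0 : t (R.mk A hA f hf) = t 0 := congrArg t h
    rw [zero_eq hA] at h0
    exact h0.mpr ⟨A, hA, by simp⟩
  · rintro ⟨a, ha, h⟩
    rw [← mk_right hA hf ha, zero_eq (Φ.tensor_mem hA ha)]
    exact mk_congr h

/-- The difference of the classes is represented on `A ⊗ B`. The criterion involves `Φ` only through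
the witness `a`, so an equality passes to another multiplicative set as soon as a witness does. -/
lemma R.mk_eq_mk_iff {Φ : MulSet K} {A B : K} {hA : Φ.mem A} {hB : Φ.mem B} {f : A ⟶ A}
    {g : B ⟶ B} {hf : IsBalanced f} {hg : IsBalanced g} :
    R.mk A hA f hf = R.mk B hB g hg ↔ ∃ a, Φ.mem a ∧ (f ▷ B - A ◁ g) ▷ a = 0 := by
  have e : R.mk A hA f hf - R.mk B hB g hg = R.mk (A ⊗ B) (Φ.tensor_mem hA hB)
      (f ▷ B + -(A ◁ g)) ((hf.whiskerRight B).add (hg.whiskerLeft A).neg) := by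
    rw [sub_eq_add_neg, ← mk_right hA hf hB, ← mk_left hB hg hA]
    exact mk_add_mk' _ _ _
  rw [← sub_eq_zero, e, mk_eq_zero_iff, sub_eq_add_neg]

end Equality
end TTGeom

namespace TTGeom

/-! ### The cone of a projector -/

section Cone

variable {L : Type u} [Category.{v} L] [Preadditive L] [HasZeroObject L]
  [HasShift L ℤ] [∀ n : ℤ, (shiftFunctor L n).Additive] [Pretriangulated L]

/-- If `X` is a direct summand of `B`, then `X ⊕ ΣX` is the cone of the complementary
projector of `B`. -/
lemma nonempty_iso_biprod_shift_of_retract {X B C : L} (e : Retract X B) {g : B ⟶ C}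
    {h : C ⟶ B⟦(1 : ℤ)⟧} (hT : Triangle.mk (𝟙 B - e.r ≫ e.i) g h ∈ distTriang L) :
    Nonempty (C ≅ X ⊞ X⟦(1 : ℤ)⟧) := by
  have hgh : g ≫ h = 0 := comp_distTriang_mor_zero₂₃ _ hT
  have hqg : (𝟙 B - e.r ≫ e.i) ≫ g = 0 := comp_distTriang_mor_zero₁₂ _ hT
  have hhq : h ≫ (𝟙 B - e.r ≫ e.i)⟦(1 : ℤ)⟧' = 0 := comp_distTriang_mor_zero₃₁ _ hT
  -- The projector `𝟙 - e.r ≫ e.i` is killed by `e.r` after it and by `e.i` before it. So `e.r`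
  -- extends over the cone, and `Σ e.i` lifts to it.
  obtain ⟨p, hp⟩ : ∃ p : C ⟶ X, e.r = g ≫ p :=
    Triangle.yoneda_exact₂ _ hT e.r (by
      change (𝟙 B - e.r ≫ e.i) ≫ e.r = 0
      simp [Preadditive.sub_comp])
  obtain ⟨t, ht⟩ : ∃ t : X⟦(1 : ℤ)⟧ ⟶ C, e.i⟦(1 : ℤ)⟧' = t ≫ h :=
    Triangle.coyoneda_exact₁ _ hT (e.i⟦(1 : ℤ)⟧') (by
      change e.i⟦(1 : ℤ)⟧' ≫ (𝟙 B - e.r ≫ e.i)⟦(1 : ℤ)⟧' = 0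
      rw [← Functor.map_comp]
      simp [Preadditive.comp_sub])
  -- The vanishing composites now read `g = e.r ≫ e.i ≫ g` and `h = h ≫ Σ(e.r) ≫ Σ(e.i)`: both maps
  -- factor through the summand.
  rw [Preadditive.sub_comp, Category.id_comp, sub_eq_zero, Category.assoc] at hqg
  rw [Functor.map_sub, CategoryTheory.Functor.map_id, Functor.map_comp, Preadditive.comp_sub, Category.comp_id,
    sub_eq_zero] at hhq
  let u : X ⟶ C := e.i ≫ g
  let w : C ⟶ X⟦(1 : ℤ)⟧ := h ≫ e.r⟦(1 : ℤ)⟧'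
  -- The lift `t` is only determined up to maps through `g`. Subtracting its component along `X`
  -- makes it orthogonal to `p`.
  let t' : X⟦(1 : ℤ)⟧ ⟶ C := t - t ≫ p ≫ u
  have hup : u ≫ p = 𝟙 X := by simp [u, ← hp]
  have huw : u ≫ w = 0 := by simp [u, w, reassoc_of% hgh]
  have htw : t ≫ w = 𝟙 _ := by
    simp only [w]
    rw [← reassoc_of% ht, ← Functor.map_comp, e.retract, CategoryTheory.Functor.map_id]
  have huh : u ≫ h = 0 := by simp [u, hgh]
  have htp' : t' ≫ p = 0 := by simp [t', Preadditive.sub_comp, hup]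
  have htw' : t' ≫ w = 𝟙 _ := by simp [t', Preadditive.sub_comp, huw, htw]
  have hth' : t' ≫ h = e.i⟦(1 : ℤ)⟧' := by simp [t', Preadditive.sub_comp, huh, ht]
  -- The defect `d` is the idempotent complementary to `X` and `ΣX` in `C`. From `g ≫ d = 0` it
  -- factors through `h`, and `d ≫ h = 0`, so `d = d ≫ d = 0`.
  let d : C ⟶ C := 𝟙 C - p ≫ u - w ≫ t'
  have hgd : g ≫ d = 0 := by
    simp [d, Preadditive.comp_sub, ← reassoc_of% hp, u, w, reassoc_of% hgh, ← hqg]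
  have hdh : d ≫ h = 0 := by
    simp only [d, Preadditive.sub_comp, Category.assoc, huh, hth', w, Category.id_comp,
      comp_zero, sub_zero]
    rw [sub_eq_zero]
    exact hhq
  have hdd : d ≫ d = d := by
    simp [d, Preadditive.comp_sub, Preadditive.sub_comp, reassoc_of% hup, reassoc_of% huw,
      reassoc_of% htp', reassoc_of% htw']
  obtain ⟨x, hx⟩ : ∃ x, d = h ≫ x := Triangle.yoneda_exact₃ _ hT d hgd
  have hd : d = 0 := by
    rw [← hdd]
    nth_rewrite 2 [hx]
    rw [reassoc_of% hdh, zero_comp]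
  refine ⟨⟨biprod.lift p w, biprod.desc u t', ?_, ?_⟩⟩
  · rw [biprod.lift_desc, ← sub_eq_zero, ← neg_eq_zero, ← hd]
    simp only [d]
    abel
  · ext <;> simp [hup, huw, htp', htw']

end Cone

/-! ### Descent of `X ⊕ ΣX` to the original category -/

section Completion

variable {K : Type u} [Category.{v} K] [Preadditive K] [HasZeroObject K]
  [HasShift K ℤ] [∀ n : ℤ, (shiftFunctor K n).Additive] [Pretriangulated K]
  {L : Type u'} [Category.{v'} L] [Preadditive L] [HasZeroObject L]
  [HasShift L ℤ] [∀ n : ℤ, (shiftFunctor L n).Additive] [Pretriangulated L]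

/-- For an idempotent completion `i : K ⥤ L` and `X ∈ L`, the object `X ⊕ ΣX` comes from `K`. -/
lemma IsIdempotentCompletion.exists_iso_biprod_shift {i : K ⥤ L} [i.CommShift ℤ]
    [i.IsTriangulated] (hi : IsIdempotentCompletion i) (X : L) :
    ∃ Y : K, Nonempty (i.obj Y ≅ X ⊞ X⟦(1 : ℤ)⟧) := by
  have := hi.full
  obtain ⟨A, ⟨e⟩⟩ := hi.exists_retract X
  -- The complementary projector may fail to split in `K`, but it has a cone there, and `i`
  -- preserves cones.
  obtain ⟨q, hq⟩ := i.map_surjective (𝟙 (i.obj A) - e.r ≫ e.i)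
  obtain ⟨Y, g, h, hT⟩ := distinguished_cocone_triangle q
  have hT' := i.map_distinguished _ hT
  refine ⟨Y, nonempty_iso_biprod_shift_of_retract e (g := i.map g)
    (h := i.map h ≫ (i.commShiftIso (1 : ℤ)).hom.app A) ?_⟩
  rw [← hq]
  exact hT'

end Completion

/-! ### The spectrum of an idempotent completion -/

section Spectrum

variable {L : Type u} [Category.{v} L] [Preadditive L] [HasZeroObject L]
  [HasShift L ℤ] [∀ n : ℤ, (shiftFunctor L n).Additive] [Pretriangulated L]
  [MonoidalCategory L]

/-- `X` is a summand of `X ⊕ ΣX`, which is in turn an extension of `ΣX` by `X`. -/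
lemma mem_iff_of_iso_biprod_shift (P : ObjectProperty L) [P.IsTriangulated]
    [P.IsStableUnderRetracts] {X Y : L} (α : Y ≅ X ⊞ X⟦(1 : ℤ)⟧) : P Y ↔ P X := by
  refine ⟨fun h => ?_, fun h => ?_⟩
  · exact P.prop_of_retract (⟨biprod.inl, biprod.fst, by simp⟩ : Retract X (X ⊞ X⟦(1 : ℤ)⟧))
      (P.prop_of_iso α h)
  · exact P.prop_of_iso α.symm (P.ext_of_isTriangulatedClosed₂ _
      (binaryBiproductTriangle_distinguished X (X⟦(1 : ℤ)⟧)) h (P.le_shift (1 : ℤ) X h))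

lemma supp_eq_of_iso_biprod_shift {X Y : L} (α : Y ≅ X ⊞ X⟦(1 : ℤ)⟧) : supp Y = supp X := by
  ext P
  exact not_congr (mem_iff_of_iso_biprod_shift P.mem α)

lemma isClosed_supp (X : L) : IsClosed (supp X) :=
  ⟨TopologicalSpace.isOpen_generateFrom_of_mem ⟨X, rfl⟩⟩

lemma Spc.ext_mem {P Q : Spc L} (h : ∀ X, P.mem X ↔ Q.mem X) : P = Q := by
  have : P.mem = Q.mem := by ext X; exact h X
  cases P; cases Q; cases this; rfl

/-- An extension of summands of objects of `P` is a summand of an extension of objects of `P`, and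
`P` is closed under extensions up to isomorphism. -/
instance ObjectProperty.retractClosure_isTriangulated (P : ObjectProperty L) [P.IsTriangulated] :
    P.retractClosure.IsTriangulated where
  exists_zero := by
    obtain ⟨Z, hZ, h⟩ := ObjectProperty.ContainsZero.exists_zero (P := P)
    exact ⟨Z, hZ, P.le_retractClosure _ h⟩
  ext₂' T hT h₁ h₃ := by
    obtain ⟨Y, hY, ⟨e⟩⟩ := ObjectProperty.extensionProduct_retractClosure_retractClosure_le P P
      T.obj₂ ⟨_, _, _, _, _, hT, h₁, h₃⟩
    obtain ⟨Z, hZ, ⟨e'⟩⟩ :=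
      ObjectProperty.extensionProduct_le_of_isTriangulatedClosed₂' le_rfl le_rfl Y hY
    exact ⟨_, ⟨Z, hZ, ⟨e.trans (Retract.ofIso e')⟩⟩, ⟨Iso.refl _⟩⟩

end Spectrum

/-! ### Primes of `K` and of its completion -/

section SpectrumCompletion

variable {K : Type u} [Category.{v} K] [Preadditive K] [HasZeroObject K]
  [HasShift K ℤ] [∀ n : ℤ, (shiftFunctor K n).Additive] [Pretriangulated K] [IsTriangulated K]
  [MonoidalCategory K] [MonoidalPreadditive K] [SymmetricCategory K] [TensorTriangulated K]
  {L : Type u'} [Category.{v'} L] [Preadditive L] [HasZeroObject L]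
  [HasShift L ℤ] [∀ n : ℤ, (shiftFunctor L n).Additive] [Pretriangulated L] [IsTriangulated L]
  [MonoidalCategory L] [MonoidalPreadditive L] [SymmetricCategory L] [TensorTriangulated L]
  (i : K ⥤ L) [i.CommShift ℤ] [i.Braided] [i.IsTriangulated]

/-- A retract of an object in the image of a fully faithful functor lies over a retract. -/
lemma Spc.mem_of_retract_map (P : Spc K) [i.Full] [i.Faithful] {A B : K} (hB : P.mem B)
    (e : Retract (i.obj A) (i.obj B)) : P.mem A := by
  obtain ⟨s, hs⟩ := i.map_surjective e.i
  obtain ⟨r, hr⟩ := i.map_surjective e.r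
  exact P.mem.prop_of_retract ⟨s, r, i.map_injective (by simp [hs, hr])⟩ hB

/-- Retractions between objects of the image lift to `K`, so passing to summands in `L` adds no
object of `K`. This yields both properness and the surjectivity of `Spc.comap`. -/
lemma retractClosure_map_obj_iff (P : Spc K) [i.Full] [i.Faithful] (A : K) :
    (P.mem.map i).retractClosure (i.obj A) ↔ P.mem A := by
  refine ⟨?_, fun h => (P.mem.map i).le_retractClosure _ (P.mem.prop_map_obj i h)⟩
  rintro ⟨Y, ⟨B, hB, ⟨e'⟩⟩, ⟨e⟩⟩
  exact P.mem_of_retract_map i hB (e.trans (Retract.ofIso e'.symm))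

/-- The prime of an idempotent completion `L` of `K` above a prime of `K`. -/
def IsIdempotentCompletion.prime (hi : IsIdempotentCompletion i) (P : Spc K) : Spc L where
  mem := (P.mem.map i).retractClosure
  isTriangulated := by
    have := hi.full
    infer_instance
  isStableUnderRetracts := inferInstance
  tensor_mem a b := by
    rintro ⟨Y, ⟨B, hB, ⟨e'⟩⟩, ⟨e⟩⟩
    obtain ⟨A, ⟨d⟩⟩ := hi.exists_retract a
    refine ⟨i.obj (A ⊗ B), P.mem.prop_map_obj i (P.tensor_mem A hB), ⟨?_⟩⟩
    have d1 : Retract (a ⊗ b) (i.obj A ⊗ b) := d.map (tensorRight b)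
    have d2 : Retract (i.obj A ⊗ b) (i.obj A ⊗ i.obj B) :=
      (e.trans (Retract.ofIso e'.symm)).map (tensorLeft (i.obj A))
    exact (d1.trans d2).trans (Retract.ofIso (Functor.Monoidal.μIso i A B))
  proper := by
    have := hi.full
    have := hi.faithful
    obtain ⟨A, hA⟩ := P.proper
    exact ⟨i.obj A, fun h => hA ((retractClosure_map_obj_iff i P A).1 h)⟩
  prime {a b} h := by
    have := hi.full
    have := hi.faithful
    obtain ⟨A, ⟨α⟩⟩ := hi.exists_iso_biprod_shift a
    obtain ⟨B, ⟨β⟩⟩ := hi.exists_iso_biprod_shift b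
    let Q := (P.mem.map i).retractClosure
    -- The objects that tensor into `Q` with a fixed object form a thick subcategory. So `b` and
    -- then `a` can be replaced by `b ⊕ Σb` and `a ⊕ Σa`, which come from `K`, where `P` is prime.
    have hl : (Q.inverseImage (tensorLeft a)).IsStableUnderRetracts :=
      ⟨fun h hY => Q.prop_of_retract (h.map (tensorLeft a)) hY⟩
    have hr : (Q.inverseImage (tensorRight (i.obj B))).IsStableUnderRetracts :=
      ⟨fun h hY => Q.prop_of_retract (h.map (tensorRight (i.obj B))) hY⟩
    have h1 : Q (a ⊗ i.obj B) :=
      (mem_iff_of_iso_biprod_shift (Q.inverseImage (tensorLeft a)) β).2 h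
    have h2 : Q (i.obj A ⊗ i.obj B) :=
      (mem_iff_of_iso_biprod_shift (Q.inverseImage (tensorRight (i.obj B))) α).2 h1
    have h3 : Q (i.obj (A ⊗ B)) := Q.prop_of_iso (Functor.Monoidal.μIso i A B) h2
    refine (P.prime ((retractClosure_map_obj_iff i P _).1 h3)).imp (fun h => ?_) (fun h => ?_)
    · exact (mem_iff_of_iso_biprod_shift Q α).1 ((retractClosure_map_obj_iff i P _).2 h)
    · exact (mem_iff_of_iso_biprod_shift Q β).1 ((retractClosure_map_obj_iff i P _).2 h)

variable {i}

lemma IsIdempotentCompletion.comap_injective (hi : IsIdempotentCompletion i) :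
    Function.Injective (Spc.comap i) := by
  intro P Q h
  refine Spc.ext_mem fun X => ?_
  obtain ⟨Y, ⟨α⟩⟩ := hi.exists_iso_biprod_shift X
  rw [← mem_iff_of_iso_biprod_shift P.mem α, ← mem_iff_of_iso_biprod_shift Q.mem α]
  exact iff_of_eq (congrArg (fun R : Spc K => R.mem Y) h)

lemma IsIdempotentCompletion.comap_surjective (hi : IsIdempotentCompletion i) :
    Function.Surjective (Spc.comap i) := by
  have := hi.full
  have := hi.faithful
  exact fun P => ⟨hi.prime i P, Spc.ext_mem fun X => retractClosure_map_obj_iff i P X⟩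

lemma comap_preimage_supp_of_iso {X : L} {Y : K} (α : i.obj Y ≅ X ⊞ X⟦(1 : ℤ)⟧) :
    Spc.comap i ⁻¹' supp Y = supp X :=
  supp_eq_of_iso_biprod_shift α

/-- The spectrum does not change under idempotent completion. -/
lemma IsIdempotentCompletion.isHomeomorph_comap (hi : IsIdempotentCompletion i) :
    IsHomeomorph (Spc.comap i) := by
  refine ⟨?_, ?_, hi.comap_injective, hi.comap_surjective⟩
  · refine continuous_generateFrom_iff.2 ?_
    rintro _ ⟨A, rfl⟩
    exact (isClosed_supp (i.obj A)).isOpen_compl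
  -- Every `supp X` is the preimage of some `supp Y`, so the topology is induced from `Spc K`. An
  -- inducing surjection is open.
  · have hind : Topology.IsInducing (Spc.comap i) := by
      refine ⟨le_antisymm ?_ ?_⟩
      · refine continuous_iff_le_induced.1 (continuous_generateFrom_iff.2 ?_)
        rintro _ ⟨A, rfl⟩
        exact (isClosed_supp (i.obj A)).isOpen_compl
      · refine le_generateFrom ?_
        rintro _ ⟨X, rfl⟩
        obtain ⟨Y, ⟨α⟩⟩ := hi.exists_iso_biprod_shift X
        exact ⟨(supp Y)ᶜ, (isClosed_supp Y).isOpen_compl,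
          by rw [Set.preimage_compl, comap_preimage_supp_of_iso α]⟩
    exact hind.isOpenMap (by rw [hi.comap_surjective.range_eq]; exact isOpen_univ)

end SpectrumCompletion

end TTGeom

namespace TTGeom

section Comparison

variable {K : Type u} [Category.{v} K] [Preadditive K] [HasZeroObject K]
  [HasShift K ℤ] [∀ n : ℤ, (shiftFunctor K n).Additive] [Pretriangulated K] [IsTriangulated K]
  [MonoidalCategory K] [MonoidalPreadditive K] [SymmetricCategory K] [TensorTriangulated K]
  {L : Type u'} [Category.{v'} L] [Preadditive L] [HasZeroObject L]
  [HasShift L ℤ] [∀ n : ℤ, (shiftFunctor L n).Additive] [Pretriangulated L] [IsTriangulated L]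
  [MonoidalCategory L] [MonoidalPreadditive L] [SymmetricCategory L] [TensorTriangulated L]

/-! ### Functors that are fully faithful -/

lemma IsBalanced.of_map (i : K ⥤ L) [i.Monoidal] [i.Faithful] {A : K} {f : A ⟶ A}
    (h : IsBalanced (i.map f)) : IsBalanced f := by
  unfold IsBalanced at *
  apply i.map_injective
  rw [← cancel_epi (Functor.LaxMonoidal.μ i A A), ← Functor.LaxMonoidal.μ_natural_left,
    ← Functor.LaxMonoidal.μ_natural_right, h]

lemma whiskerRight_eq_zero_of_map (i : K ⥤ L) [i.Monoidal] [i.Additive] [i.Faithful] {A B : K}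
    {f : A ⟶ A} (h : i.map f ▷ i.obj B = 0) : f ▷ B = 0 := by
  apply i.map_injective
  rw [← cancel_epi (Functor.LaxMonoidal.μ i A B), ← Functor.LaxMonoidal.μ_natural_left, h]
  simp

/-- The criterion for the injectivity of `R_Φ → R_Ψ` along a faithful functor. -/
lemma R.map_injective (i : K ⥤ L) [i.Monoidal] [i.Additive] [i.Faithful] {Φ : MulSet K}
    {Ψ : MulSet L} (h : ∀ A, Φ.mem A → Ψ.mem (i.obj A))
    (H : ∀ {A : K} (_ : Φ.mem A) (f : A ⟶ A) {W : L} (_ : Ψ.mem W), i.map f ▷ W = 0 →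
      ∃ B, Φ.mem B ∧ i.map f ▷ i.obj B = 0) :
    Function.Injective (R.map i h) := by
  refine (injective_iff_map_eq_zero _).2 fun r hr => ?_
  induction r using R.ind with | _ A hA f hf
  rw [R.map_mk, R.mk_eq_zero_iff] at hr
  obtain ⟨W, hW, h0⟩ := hr
  obtain ⟨B, hB, hB0⟩ := H hA f hW h0
  exact R.mk_eq_zero_iff.2 ⟨B, hB, whiskerRight_eq_zero_of_map i hB0⟩

/-- A class is in the image of `R_Φ → R_Ψ` along a fully faithful functor `i` as soon as it has a
representative on an object isomorphic to some `i(A)` with `A ∈ Φ`. -/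
lemma R.exists_map_eq (i : K ⥤ L) [i.Monoidal] [i.Additive] [i.Full] [i.Faithful] {Φ : MulSet K}
    {Ψ : MulSet L} (h : ∀ A, Φ.mem A → Ψ.mem (i.obj A)) {A : K} (hA : Φ.mem A) {W : L}
    (e : i.obj A ≅ W) {hW : Ψ.mem W} {f : W ⟶ W} {hf : IsBalanced f} :
    ∃ (g : A ⟶ A) (hg : IsBalanced g), i.map g = e.hom ≫ f ≫ e.inv ∧
      R.map i h (R.mk A hA g hg) = R.mk W hW f hf := by
  obtain ⟨g, hg⟩ := i.map_surjective (e.hom ≫ f ≫ e.inv)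
  have hb : IsBalanced g := by
    refine IsBalanced.of_map i ?_
    rw [hg]
    exact hf.of_retract (Retract.ofIso e)
  exact ⟨g, hb, hg, R.mk_iso e (by simp [hg])⟩

/-! ### The comparison maps under a morphism of tensor triangulated categories -/

lemma Spc.coneMem_comap_iff (i : K ⥤ L) [i.CommShift ℤ] [i.Braided] [i.IsTriangulated]
    (Q : Spc L) {A B : K} (f : A ⟶ B) : (Spc.comap i Q).ConeMem f ↔ Q.ConeMem (i.map f) :=
  Q.mem.inverseImage_trW_iff i f

/-- The comparison maps are natural along `R_Φ → R_Ψ`. -/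
lemma comap_rho_map (i : K ⥤ L) [i.CommShift ℤ] [i.Braided] [i.IsTriangulated] {Φ : MulSet K}
    {Ψ : MulSet L} (h : ∀ A, Φ.mem A → Ψ.mem (i.obj A)) {φ : R Φ →+* R Ψ}
    (hφ : ∀ r, φ r = R.map i h r) {Q : Spc L} (hQ : Q ∈ Ψ.Z) (hP : Spc.comap i Q ∈ Φ.Z) :
    PrimeSpectrum.comap φ (rho Ψ ⟨Q, hQ⟩) = rho Φ ⟨Spc.comap i Q, hP⟩ := by
  ext r
  induction r using R.ind with | _ A hA f hf
  change φ _ ∈ rhoSet Ψ Q ↔ _ ∈ rhoSet Φ (Spc.comap i Q)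
  rw [hφ, R.map_mk, mk_mem_rhoSet hQ, mk_mem_rhoSet hP, Spc.coneMem_comap_iff]

lemma MulSet.comap_preimage_Z (i : K ⥤ L) [i.CommShift ℤ] [i.Braided] [i.IsTriangulated]
    (Φ : MulSet K) : Spc.comap i ⁻¹' Φ.Z = (Φ.map i).Z := by
  ext Q
  refine ⟨fun h => Set.mem_iInter₂.2 ?_, fun h => Set.mem_iInter₂.2 fun A hA => ?_⟩
  · rintro W ⟨A, hA, ⟨e⟩⟩ hW
    exact MulSet.not_mem_of_mem_Z h hA (Q.mem.prop_of_iso e.symm hW)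
  · exact MulSet.not_mem_of_mem_Z h (Φ.map_mem i A hA)

/-! ### Multiplicative sets and closed subsets under idempotent completion -/

/-- Objects of `Φ.map i` are isomorphic to images of objects of `Φ`, so both representatives and
annihilating objects can be transported along these isomorphisms. -/
lemma R.map_bijective (i : K ⥤ L) [i.Monoidal] [i.Additive] [i.Full] [i.Faithful]
    (Φ : MulSet K) : Function.Bijective (R.map i (Φ.map_mem i)) := by
  refine ⟨R.map_injective i _ ?_, fun r => ?_⟩
  · rintro A - f W ⟨B, hB, ⟨e⟩⟩ h
    exact ⟨B, hB, whiskerRight_eq_zero_of_retract h (Retract.ofIso e)⟩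
  · induction r using R.ind with | _ W hW f hf
    obtain ⟨A, hA, ⟨e⟩⟩ := hW
    obtain ⟨g, hg, -, h⟩ := R.exists_map_eq i (Φ.map_mem i) hA e
    exact ⟨_, h⟩

/-- The inclusion of supports holds after pulling back to `Spc L`, and surjectivity of `Spc.comap i`
allows the preimages to be cancelled. -/
lemma closedSet_mem_of_iso (i : K ⥤ L) [i.CommShift ℤ] [i.Braided] [i.IsTriangulated]
    (hi : IsIdempotentCompletion i) {Z : Set (Spc K)} {W : L}
    (hW : (closedSet (Spc.comap i ⁻¹' Z)).mem W) {A : K} (α : i.obj A ≅ W ⊞ W⟦(1 : ℤ)⟧) :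
    (closedSet Z).mem A := by
  have h : Spc.comap i ⁻¹' Z ⊆ Spc.comap i ⁻¹' supp A :=
    (show Spc.comap i ⁻¹' Z ⊆ supp W from hW).trans (comap_preimage_supp_of_iso α).ge
  exact (Set.preimage_subset_preimage_iff (by simp [hi.comap_surjective.range_eq])).1 h

/-- Replacing `W` by `W ⊕ ΣW` does not change its support and brings it into the image of `K`.
Applied to the annihilating object this gives injectivity, and applied to the object carrying a
representative it gives surjectivity. -/
lemma R.map_closedSet_bijective (i : K ⥤ L) [i.CommShift ℤ] [i.Braided] [i.IsTriangulated]
    (hi : IsIdempotentCompletion i) (Z : Set (Spc K)) :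
    Function.Bijective (R.map i (closedSet_map i Z)) := by
  have := hi.full
  have := hi.faithful
  refine ⟨R.map_injective i _ ?_, fun r => ?_⟩
  · intro A _ f W hW h
    obtain ⟨B, ⟨α⟩⟩ := hi.exists_iso_biprod_shift W
    exact ⟨B, closedSet_mem_of_iso i hi hW α, whiskerRight_eq_zero_of_biprod_shift h α⟩
  · induction r using R.ind with | _ W hW f hf
    obtain ⟨A, ⟨α⟩⟩ := hi.exists_iso_biprod_shift W
    have hA := closedSet_mem_of_iso i hi hW α
    obtain ⟨g, hg, -, h⟩ := R.exists_map_eq i (closedSet_map i Z) hA (Iso.refl _)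
      (hW := closedSet_map i Z A hA) (hf := hf.biprod_shift α)
    exact ⟨_, h.trans (R.mk_eq_mk_of_twin (hf.twin.biprod_shift α)).symm⟩

/-! ### Tensor powers -/

lemma nonempty_tensorPow_iso (i : K ⥤ L) [i.Monoidal] (Y : K) (n : ℕ) :
    Nonempty (i.obj (tensorPow Y n) ≅ tensorPow (i.obj Y) n) := by
  induction n with
  | zero => exact ⟨Iso.refl _⟩
  | succ n ih =>
    obtain ⟨e⟩ := ih
    exact ⟨(Functor.Monoidal.μIso i _ _).symm ≪≫ (e ⊗ᵢ Iso.refl _)⟩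

/-- A retract of `X` in `Y` induces retracts of the tensor powers. -/
lemma nonempty_retract_tensorPow {X Y : L} (e : Retract X Y) (n : ℕ) :
    Nonempty (Retract (tensorPow X n) (tensorPow Y n)) := by
  induction n with
  | zero => exact ⟨e⟩
  | succ n ih =>
    obtain ⟨d⟩ := ih
    exact ⟨(d.map (tensorRight X)).trans (e.map (tensorLeft (tensorPow Y n)))⟩

lemma nonempty_tensor_iso_biprod_shift {X Y : L} (α : Y ≅ X ⊞ X⟦(1 : ℤ)⟧) (A : L) :
    Nonempty (A ⊗ Y ≅ (A ⊗ X) ⊞ (A ⊗ X)⟦(1 : ℤ)⟧) := by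
  have := preservesBinaryBiproducts_of_preservesBiproducts (tensorLeft A)
  exact ⟨(tensorLeft A).mapIso α ≪≫ (tensorLeft A).mapBiprod X (X⟦(1 : ℤ)⟧) ≪≫
    biprod.mapIso (Iso.refl _) (((tensorLeft A).commShiftIso (1 : ℤ)).app X)⟩

/-- If `Y = X ⊕ ΣX`, a property which is stable under `W ↦ W ⊕ ΣW` passes from `X^{⊗n}` to
`Y^{⊗n}`. -/
lemma prop_tensorPow_of_iso_biprod_shift {X Y : L} (α : Y ≅ X ⊞ X⟦(1 : ℤ)⟧)
    (N : ObjectProperty L) [N.IsClosedUnderIsomorphisms]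
    (hN : ∀ {W W' : L}, (W' ≅ W ⊞ W⟦(1 : ℤ)⟧) → N W → N W') (n : ℕ)
    (h : N (tensorPow X n)) : N (tensorPow Y n) := by
  -- The arbitrary factor `A` makes it possible to exchange one `X` for `Y` at a time, without
  -- expanding `(X ⊕ ΣX)^{⊗n}`.
  suffices H : ∀ A, N (A ⊗ tensorPow X n) → N (A ⊗ tensorPow Y n) from
    N.prop_of_iso (λ_ _) (H (𝟙_ L) (N.prop_of_iso (λ_ _).symm h))
  clear h
  have step (A : L) (h : N (A ⊗ X)) : N (A ⊗ Y) := by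
    obtain ⟨e⟩ := nonempty_tensor_iso_biprod_shift α A
    exact hN e h
  induction n with
  | zero => exact step
  | succ n ih =>
    intro A h
    have h1 : N ((A ⊗ tensorPow X n) ⊗ Y) := step _ (N.prop_of_iso (α_ _ _ _).symm h)
    -- The exchanged factor `Y` is absorbed into the free factor, so the induction hypothesis
    -- applies with `Y ⊗ A` for `A`.
    have h2 : N ((Y ⊗ A) ⊗ tensorPow X n) := N.prop_of_iso (β_ _ _ ≪≫ (α_ _ _ _).symm) h1
    exact N.prop_of_iso (α_ _ _ _ ≪≫ β_ _ _ ≪≫ α_ _ _ _) (ih _ h2)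

/-! ### Object comparison maps under idempotent completion -/

/-- The multiplicative set of the objects which have a tensor power `X^{⊗n}` as a direct
summand. -/
def retractSet (X : L) : MulSet L where
  mem W := ∃ n : ℕ, Nonempty (Retract (tensorPow X n) W)
  nonempty := ⟨X, 0, ⟨Retract.refl _⟩⟩
  tensor_mem := by
    rintro W W' ⟨m, ⟨e⟩⟩ ⟨n, ⟨e'⟩⟩
    obtain ⟨d⟩ := tensorPow_add X m n
    exact ⟨m + n + 1, ⟨(Retract.ofIso d.symm).trans
      ((e.map (tensorRight _)).trans (e'.map (tensorLeft W)))⟩⟩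

lemma objectSet_le_retractSet (X : L) (W : L) (hW : (objectSet X).mem W) :
    (retractSet X).mem W := by
  obtain ⟨n, ⟨e⟩⟩ := hW
  exact ⟨n, ⟨Retract.ofIso e.symm⟩⟩

lemma objectSet_mem_tensorPow (X : L) (n : ℕ) : (objectSet X).mem (tensorPow X n) :=
  ⟨n, ⟨Iso.refl _⟩⟩

lemma mem_Z_retractSet {X : L} {Q : Spc L} (hQ : Q ∈ supp X) : Q ∈ (retractSet X).Z := by
  refine Set.mem_iInter₂.2 ?_
  rintro W ⟨n, ⟨e⟩⟩ hW
  exact MulSet.not_mem_of_mem_Z ((objectSet_Z X).ge hQ) (objectSet_mem_tensorPow X n)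
    (Q.mem.prop_of_retract e hW)

/-- A class on `W` equals the class of its compression to a tensor power of `X` inside `W`, and an
endomorphism annihilated by `W` is annihilated by that tensor power. -/
lemma R.incl_retractSet_bijective (X : L) :
    Function.Bijective (R.incl (objectSet_le_retractSet X)) := by
  refine ⟨(injective_iff_map_eq_zero _).2 fun r hr => ?_, fun r => ?_⟩
  · induction r using R.ind with | _ A hA f hf
    obtain ⟨W, ⟨n, ⟨e⟩⟩, h⟩ := R.mk_eq_zero_iff.1 hr
    exact R.mk_eq_zero_iff.2
      ⟨_, objectSet_mem_tensorPow X n, whiskerRight_eq_zero_of_retract h e⟩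
  · induction r using R.ind with | _ W hW f hf
    obtain ⟨n, ⟨e⟩⟩ := hW
    exact ⟨R.mk _ (objectSet_mem_tensorPow X n) _ (hf.of_retract e),
      R.mk_eq_mk_of_twin (hf.twin.of_retract e).symm⟩

variable (i : K ⥤ L) [i.CommShift ℤ] [i.Braided] [i.IsTriangulated] {X : L} {Y : K}

lemma map_mem_retractSet (α : i.obj Y ≅ X ⊞ X⟦(1 : ℤ)⟧) (A : K) (hA : (objectSet Y).mem A) :
    (retractSet X).mem (i.obj A) := by
  obtain ⟨n, ⟨e⟩⟩ := hA
  obtain ⟨e'⟩ := nonempty_tensorPow_iso i Y n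
  have d : Retract X (i.obj Y) :=
    (⟨biprod.inl, biprod.fst, by simp⟩ : Retract X (X ⊞ X⟦(1 : ℤ)⟧)).trans
      (Retract.ofIso α.symm)
  obtain ⟨d'⟩ := nonempty_retract_tensorPow d n
  exact ⟨n, ⟨d'.trans (Retract.ofIso (e'.symm ≪≫ i.mapIso e.symm))⟩⟩

variable (α : i.obj Y ≅ X ⊞ X⟦(1 : ℤ)⟧)

/-- Annihilation and the existence of a representative first pass from `W` to its summand `X^{⊗n}`.
They then pass to `i(Y)^{⊗n}` by `prop_tensorPow_of_iso_biprod_shift`, since both are stable under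
`W ↦ W ⊕ ΣW`. -/
lemma R.map_retractSet_bijective [i.Full] [i.Faithful] :
    Function.Bijective (R.map i (map_mem_retractSet i α)) := by
  refine ⟨R.map_injective i _ ?_, fun r => ?_⟩
  · rintro A - f W ⟨n, ⟨e⟩⟩ h
    let N : ObjectProperty L := fun W => i.map f ▷ W = 0
    have : N.IsClosedUnderIsomorphisms :=
      ⟨fun e h => whiskerRight_eq_zero_of_retract h (Retract.ofIso e.symm)⟩
    have h' : N (tensorPow (i.obj Y) n) := prop_tensorPow_of_iso_biprod_shift α N
      (fun β h => whiskerRight_eq_zero_of_biprod_shift h β) n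
      (whiskerRight_eq_zero_of_retract h e)
    obtain ⟨e'⟩ := nonempty_tensorPow_iso i Y n
    exact ⟨_, objectSet_mem_tensorPow Y n, N.prop_of_iso e'.symm h'⟩
  -- Here `N W` means that the given class `r` has a representative on `W`.
  · let N : ObjectProperty L := fun W => ∃ (hW : (retractSet X).mem W) (f : W ⟶ W)
      (hf : IsBalanced f), r = R.mk W hW f hf
    have : N.IsClosedUnderIsomorphisms := ⟨by
      rintro W W' e ⟨⟨n, ⟨d⟩⟩, f, hf, rfl⟩
      exact ⟨⟨n, ⟨d.trans (Retract.ofIso e)⟩⟩, _, hf.of_retract (Retract.ofIso e.symm),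
        R.mk_eq_mk_of_twin (hf.twin.of_retract (Retract.ofIso e.symm))⟩⟩
    obtain ⟨s, hs⟩ := (R.incl_retractSet_bijective X).2 r
    induction s using R.ind with | _ W hW f hf
    obtain ⟨n, ⟨e⟩⟩ := hW
    have h0 : N (tensorPow X n) := N.prop_of_iso e ⟨_, f, hf, hs.symm⟩
    obtain ⟨hV, g, hg, hr⟩ := prop_tensorPow_of_iso_biprod_shift α N (by
      rintro W W' β ⟨⟨n, ⟨d⟩⟩, f, hf, h⟩
      refine ⟨⟨n, ⟨d.trans (Retract.trans ⟨biprod.inl, biprod.fst, by simp⟩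
        (Retract.ofIso β.symm))⟩⟩, _, hf.biprod_shift β, h.trans ?_⟩
      exact R.mk_eq_mk_of_twin (hf.twin.biprod_shift β)) n h0
    obtain ⟨e'⟩ := nonempty_tensorPow_iso i Y n
    obtain ⟨k, hk, -, h⟩ := R.exists_map_eq i (map_mem_retractSet i α)
      (objectSet_mem_tensorPow Y n) e' (hW := hV) (hf := hg)
    exact ⟨_, h.trans hr.symm⟩

/-- The canonical isomorphism `R_X ≅ R_Y` for `i(Y) ≅ X ⊕ ΣX`. -/
noncomputable def objectEquiv [i.Full] [i.Faithful] : R (objectSet X) ≃+* R (objectSet Y) :=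
  (RingEquiv.ofBijective _ (R.incl_retractSet_bijective X)).trans
    (RingEquiv.ofBijective _ (R.map_retractSet_bijective i α)).symm

/-- This relation determines `objectEquiv`, because `R.map_retractSet_bijective` makes the left-hand
map injective. The later properties of the isomorphism are deduced from it. -/
lemma map_objectEquiv [i.Full] [i.Faithful] (r : R (objectSet X)) :
    R.map i (map_mem_retractSet i α) (objectEquiv i α r) =
      R.incl (objectSet_le_retractSet X) r :=
  (RingEquiv.ofBijective _ (R.map_retractSet_bijective i α)).apply_symm_apply _

/-- The canonical isomorphism sends `[f]` to `[f ⊕ Σf]`. -/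
lemma objectEquiv_mk [i.Full] [i.Faithful] {f : X ⟶ X} (hf : IsBalanced f) :
    ∃ (g : Y ⟶ Y) (hg : IsBalanced g),
      i.map g = α.hom ≫ biprod.map f (f⟦(1 : ℤ)⟧') ≫ α.inv ∧
      objectEquiv i α (R.mk X (objectSet_mem_self X) f hf) =
        R.mk Y (objectSet_mem_self Y) g hg := by
  obtain ⟨g, hg, hg', h⟩ := R.exists_map_eq i (map_mem_retractSet i α) (objectSet_mem_self Y)
    (Iso.refl _) (hW := map_mem_retractSet i α Y (objectSet_mem_self Y))
    (hf := hf.biprod_shift α)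
  refine ⟨g, hg, by simpa using hg', (R.map_retractSet_bijective i α).1 ?_⟩
  rw [h, map_objectEquiv]
  exact R.mk_eq_mk_of_twin (hf.twin.biprod_shift α)

/-- The set `Ψ` need not be comparable with `retractSet X`. However, a witness of the equality over
`retractSet X` has some `X^{⊗n}` as a summand; that tensor power is again a witness, and it lies in
`Ψ`. -/
lemma map_objectEquiv_of_le [i.Full] [i.Faithful] {Ψ : MulSet L}
    (hX : ∀ W, (objectSet X).mem W → Ψ.mem W)
    (hY : ∀ W, (objectSet Y).mem W → Ψ.mem (i.obj W)) (r : R (objectSet X)) :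
    R.map i hY (objectEquiv i α r) = R.incl hX r := by
  have h := map_objectEquiv i α r
  generalize objectEquiv i α r = s at h ⊢
  induction r using R.ind with | _ A hA f hf
  induction s using R.ind with | _ B hB g hg
  obtain ⟨W, ⟨n, ⟨e⟩⟩, h0⟩ := R.mk_eq_mk_iff.1 h
  exact R.mk_eq_mk_iff.2
    ⟨_, hX _ (objectSet_mem_tensorPow X n), whiskerRight_eq_zero_of_retract h0 e⟩

/-- Representatives of `r` and of its image have equal classes over `retractSet X`. As `Q` lies in
the corresponding `𝒵`, their cones lie in `Q` simultaneously by `R.coneMem_congr`. -/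
lemma comap_objectRho_objectEquiv [i.Full] [i.Faithful] {Q : Spc L} (hQ : Q ∈ supp X)
    (hP : Spc.comap i Q ∈ supp Y) :
    PrimeSpectrum.comap (objectEquiv i α : R (objectSet X) →+* R (objectSet Y))
      (objectRho Y ⟨Spc.comap i Q, hP⟩) = objectRho X ⟨Q, hQ⟩ := by
  ext r
  change objectEquiv i α r ∈ rhoSet (objectSet Y) (Spc.comap i Q) ↔ r ∈ rhoSet (objectSet X) Q
  have h := map_objectEquiv i α r
  generalize objectEquiv i α r = s at h ⊢
  induction r using R.ind with | _ A hA f hf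
  induction s using R.ind with | _ B hB g hg
  rw [mk_mem_rhoSet ((objectSet_Z Y).ge hP), mk_mem_rhoSet ((objectSet_Z X).ge hQ),
    Spc.coneMem_comap_iff]
  exact not_congr (R.coneMem_congr (mem_Z_retractSet hQ) h)

end Comparison

end TTGeom

theorem mainTheorem10
    {K : Type u} [Category.{v} K] [Preadditive K] [Limits.HasZeroObject K] [HasShift K ℤ]
    [∀ n : ℤ, (shiftFunctor K n).Additive] [Pretriangulated K] [IsTriangulated K]
    [MonoidalCategory K] [MonoidalPreadditive K] [SymmetricCategory K] [TensorTriangulated K]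
    {L : Type u'} [Category.{v'} L] [Preadditive L] [Limits.HasZeroObject L] [HasShift L ℤ]
    [∀ n : ℤ, (shiftFunctor L n).Additive] [Pretriangulated L] [IsTriangulated L]
    [MonoidalCategory L] [MonoidalPreadditive L] [SymmetricCategory L] [TensorTriangulated L]
    (i : K ⥤ L) [i.CommShift ℤ] [i.Braided] [IsTensorTriangulatedFunctor i]
    (hi : IsIdempotentCompletion i) :
    IsHomeomorph (Spc.comap i) ∧
    (∀ Φ : MulSet K,
      Spc.comap i ⁻¹' Φ.Z = (Φ.map i).Z ∧
      ∃ e : R Φ ≃+* R (Φ.map i),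
        (∀ r : R Φ, e r = R.map i (Φ.map_mem i) r) ∧
        ∀ (Q : Spc L) (hQ : Q ∈ (Φ.map i).Z) (hP : Spc.comap i Q ∈ Φ.Z),
          PrimeSpectrum.comap (e : R Φ →+* R (Φ.map i)) (rho (Φ.map i) ⟨Q, hQ⟩) =
            rho Φ ⟨Spc.comap i Q, hP⟩) ∧
    (∀ X : L,
      (∃ Y : K, Nonempty (i.obj Y ≅ X ⊞ X⟦(1 : ℤ)⟧)) ∧
      ∀ (Y : K) (α : i.obj Y ≅ X ⊞ X⟦(1 : ℤ)⟧),
        Spc.comap i ⁻¹' supp Y = supp X ∧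
        ∃ e : R (objectSet X) ≃+* R (objectSet Y),
          (∀ (f : X ⟶ X) (hf : IsBalanced f), ∃ (g : Y ⟶ Y) (hg : IsBalanced g),
            i.map g = α.hom ≫ Limits.biprod.map f (f⟦(1 : ℤ)⟧') ≫ α.inv ∧
            e (R.mk X (objectSet_mem_self X) f hf) = R.mk Y (objectSet_mem_self Y) g hg) ∧
          (∀ (Ψ : MulSet L) (hX : ∀ W, (objectSet X).mem W → Ψ.mem W)
            (hY : ∀ W, (objectSet Y).mem W → Ψ.mem (i.obj W)) (r : R (objectSet X)),
            R.map i hY (e r) = R.incl hX r) ∧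
          ∀ (Q : Spc L) (hQ : Q ∈ supp X) (hP : Spc.comap i Q ∈ supp Y),
            PrimeSpectrum.comap (e : R (objectSet X) →+* R (objectSet Y))
              (objectRho Y ⟨Spc.comap i Q, hP⟩) = objectRho X ⟨Q, hQ⟩) ∧
    (∀ Z : Set (Spc K), IsClosed Z →
      ∃ e : R (closedSet Z) ≃+* R (closedSet (Spc.comap i ⁻¹' Z)),
        (∀ r : R (closedSet Z), e r = R.map i (closedSet_map i Z) r) ∧
        ∀ (Q : Spc L) (hQ : Spc.comap i Q ∈ Z),
          PrimeSpectrum.comap (e : R (closedSet Z) →+* R (closedSet (Spc.comap i ⁻¹' Z)))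
              (closedRho (Spc.comap i ⁻¹' Z) ⟨Q, hQ⟩) =
            closedRho Z ⟨Spc.comap i Q, hQ⟩) := by
  have := hi.full
  have := hi.faithful
  refine ⟨hi.isHomeomorph_comap, fun Φ => ⟨Φ.comap_preimage_Z i, ?_⟩,
    fun X => ⟨hi.exists_iso_biprod_shift X, fun Y α => ⟨comap_preimage_supp_of_iso α, ?_⟩⟩,
    fun Z _ => ?_⟩
  · exact ⟨RingEquiv.ofBijective _ (R.map_bijective i Φ), fun _ => rfl,
      fun Q hQ hP => comap_rho_map i (Φ.map_mem i) (fun _ => rfl) hQ hP⟩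
  · exact ⟨objectEquiv i α, fun f hf => objectEquiv_mk i α hf,
      fun Ψ hX hY r => map_objectEquiv_of_le i α hX hY r,
      fun Q hQ hP => comap_objectRho_objectEquiv i α hQ hP⟩
  · exact ⟨RingEquiv.ofBijective _ (R.map_closedSet_bijective i hi Z), fun _ => rfl,
      fun Q hQ => comap_rho_map i (closedSet_map i Z) (fun _ => rfl) _ _⟩
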